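/- Let $\ell>0$ and let $\Omega_\ell=\{(x,y)\in\mathbb R^2: 0<y<\sqrt3\,x,\ y<\sqrt3(\ell-x)\}$ be the equilateral triangle with side length $\ell$. The Dirichlet eigenvalues of $\Omega_\ell$ are the real numbers $\lambda$ for which there is a nonzero $u\in H^2(\Omega_\ell)\cap H^1_0(\Omega_\ell)$ with $\Delta u+\lambda u=0$ in $\Omega_\ell$; the multiplicity of $\lambda$ is the dimension of the space of such $u$ (together with $0$), and the Dirichlet heat trace is $H(t)=\sum_k e^{-\lambda_k t}$, $t>0$, the sum over all Dirichlet eigenvalues counted with multiplicity. For $0<q<1$ put $\Theta_2(q)=\sum_{n\in\mathbb Z}q^{(n+1/2)^2}$ and $\Theta_3(q)=\sum_{n\in\mathbb Z}q^{n^2}$. Then for every $t>0$, with $q=e^{-\frac{16\pi^2}{27\ell^2}t}$, $$H(t)=\frac{\Theta_3(q^3)\Theta_3(q^9)+\Theta_2(q^3)\Theta_2(q^9)-3\Theta_3(q^3)+2}{6} =\sum_{m=1}^\infty\sum_{n=1}^\infty e^{-\frac{16\pi^2}{9\ell^2}(m^2+mn+n^2)t}.$$ The Dirichlet eigenvalues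 of $\Omega_\ell$ are exactly the numbers $\frac{16\pi^2}{9\ell^2}(m^2+mn+n^2)$ with integers $m,n\ge1$, and the multiplicity of each eigenvalue $\lambda$ is the number of pairs $(m,n)$, $m,n\geq 1$, with $\lambda=\frac{16\pi^2}{9\ell^2}(m^2+mn+n^2)$. For integers $a,b$ let $O(a,b)=\{(-b,a-b),(-b,-a),(b-a,-a),(b-a,b),(a,b),(a,a-b)\}$, and call such a set admissible if each of its pairs $(a',b')$ satisfies (A) $a'+b'\equiv0\pmod 3$, (B) $a'\ne2b'$, (C) $b'\ne2a'$ and (D) $a'\ne-b'$. Then to each pair of integers $m,n\ge1$ corresponds exactly one admissible set: $(m,n)\mapsto O(2m+n,m+2n)$ is a bijection from the pairs of positive integers onto the admissible sets, and every $(a,b)\in O(2m+n,m+2n)$ satisfies $\frac{16\pi^2}{27\ell^2}(a^2-ab+b^2)=\frac{16\pi^2}{9\ell^2}(m^2+mn+n^2)$. -/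

import Mathlib

open MeasureTheory
open scoped ENNReal ContDiff

noncomputable section

namespace EquilateralTriangle

/-- The Euclidean plane. -/
abbrev Plane : Type := EuclideanSpace ℝ (Fin 2)

/-- The open equilateral triangle with side length `ℓ` and vertices `(0, 0)`, `(ℓ, 0)` and
`(ℓ / 2, √3 ℓ / 2)`. -/
def triangle (ℓ : ℝ) : Set Plane :=
  {p | 0 < p 1 ∧ p 1 < √3 * p 0 ∧ p 1 < √3 * (ℓ - p 0)}

/-! ### Sobolev spaces and Dirichlet eigenfunctions on a plane domain -/

/-- The classical partial derivative `∂_i φ`. -/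
def partialDeriv (i : Fin 2) (φ : Plane → ℂ) (x : Plane) : ℂ :=
  fderiv ℝ φ x (EuclideanSpace.single i 1)

/-- `φ ∈ C_c^∞(Ω)`. -/
structure IsTestFunction (Ω : Set Plane) (φ : Plane → ℂ) : Prop where
  smooth : ContDiff ℝ ∞ φ
  compactSupport : HasCompactSupport φ
  support_subset : tsupport φ ⊆ Ω

/-- The Hilbert space `L²(Ω)` of complex-valued functions. -/
abbrev L2 (Ω : Set Plane) : Type := Lp ℂ 2 (volume.restrict Ω)

/-- `g` is the weak partial derivative `∂_i u` in `Ω`. -/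
def HasWeakPartial (Ω : Set Plane) (i : Fin 2) (u g : L2 Ω) : Prop :=
  ∀ φ : Plane → ℂ, IsTestFunction Ω φ →
    ∫ x in Ω, u x * partialDeriv i φ x = -∫ x in Ω, g x * φ x

/-- `g = (g 0, g 1)` and `h = (h i j)` are the weak first and second partial derivatives of
`u` in `Ω`, all of them in `L²(Ω)`; that is, `u ∈ H²(Ω)` with these derivatives. -/
structure HasWeakSecondPartials (Ω : Set Plane) (u : L2 Ω) (g : Fin 2 → L2 Ω)
    (h : Fin 2 → Fin 2 → L2 Ω) : Prop where
  first : ∀ i, HasWeakPartial Ω i u (g i)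
  second : ∀ i j, HasWeakPartial Ω j (g i) (h i j)

/-- `u ∈ H¹₀(Ω)`: `u` has weak first derivatives in `L²(Ω)` and lies in the closure of
`C_c^∞(Ω)` with respect to the `H¹(Ω)` norm. -/
def MemH10 (Ω : Set Plane) (u : L2 Ω) : Prop :=
  ∃ g : Fin 2 → L2 Ω, (∀ i, HasWeakPartial Ω i u (g i)) ∧
    ∀ ε : ℝ≥0∞, 0 < ε → ∃ φ : Plane → ℂ, IsTestFunction Ω φ ∧
      eLpNorm (fun x => u x - φ x) 2 (volume.restrict Ω) < ε ∧
      ∀ i, eLpNorm (fun x => g i x - partialDeriv i φ x) 2 (volume.restrict Ω) < ε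

/-- `u ∈ H²(Ω) ∩ H¹₀(Ω)` and `Δ u + lam u = 0` in `Ω`. The zero function is allowed. -/
def SolvesDirichlet (Ω : Set Plane) (lam : ℝ) (u : L2 Ω) : Prop :=
  MemH10 Ω u ∧ ∃ (g : Fin 2 → L2 Ω) (h : Fin 2 → Fin 2 → L2 Ω),
    HasWeakSecondPartials Ω u g h ∧ h 0 0 + h 1 1 + (lam : ℂ) • u = 0

theorem IsTestFunction.zero (Ω : Set Plane) : IsTestFunction Ω 0 :=
  ⟨contDiff_const, HasCompactSupport.zero, by simp [tsupport]⟩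

theorem IsTestFunction.add {Ω : Set Plane} {φ ψ : Plane → ℂ} (hφ : IsTestFunction Ω φ)
    (hψ : IsTestFunction Ω ψ) : IsTestFunction Ω (φ + ψ) :=
  ⟨hφ.smooth.add hψ.smooth, hφ.compactSupport.add hψ.compactSupport,
    (tsupport_add φ ψ).trans (Set.union_subset hφ.support_subset hψ.support_subset)⟩

theorem IsTestFunction.smul {Ω : Set Plane} {φ : Plane → ℂ} (c : ℂ) (hφ : IsTestFunction Ω φ) :
    IsTestFunction Ω (c • φ) :=
  ⟨hφ.smooth.const_smul c, hφ.compactSupport.smul_left (f := fun _ => c),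
    (tsupport_smul_subset_right (fun _ => c) φ).trans hφ.support_subset⟩

theorem IsTestFunction.memLp {Ω : Set Plane} {φ : Plane → ℂ} (hφ : IsTestFunction Ω φ) :
    MemLp φ 2 (volume.restrict Ω) :=
  (hφ.smooth.continuous.memLp_of_hasCompactSupport hφ.compactSupport).restrict Ω

theorem IsTestFunction.memLp_partialDeriv {Ω : Set Plane} {φ : Plane → ℂ}
    (hφ : IsTestFunction Ω φ) (i : Fin 2) : MemLp (partialDeriv i φ) 2 (volume.restrict Ω) := by
  have hc : Continuous (partialDeriv i φ) :=
    (hφ.smooth.continuous_fderiv (by simp)).clm_apply continuous_const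
  have hs : HasCompactSupport (partialDeriv i φ) :=
    (hφ.compactSupport.fderiv ℝ).comp_left (g := fun L : Plane →L[ℝ] ℂ =>
      L (EuclideanSpace.single i 1)) rfl
  exact (hc.memLp_of_hasCompactSupport hs).restrict Ω

theorem L2.integrable_mul {Ω : Set Plane} (u : L2 Ω) {ψ : Plane → ℂ}
    (hψ : MemLp ψ 2 (volume.restrict Ω)) :
    Integrable (fun x => u x * ψ x) (volume.restrict Ω) :=
  MemLp.integrable_mul (Lp.memLp u) hψ

theorem L2.integral_add_mul {Ω : Set Plane} (u v : L2 Ω) {ψ : Plane → ℂ}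
    (hψ : MemLp ψ 2 (volume.restrict Ω)) :
    ∫ x in Ω, (u + v : L2 Ω) x * ψ x = (∫ x in Ω, u x * ψ x) + ∫ x in Ω, v x * ψ x := by
  rw [← integral_add (L2.integrable_mul u hψ) (L2.integrable_mul v hψ)]
  apply integral_congr_ae
  filter_upwards [Lp.coeFn_add u v] with x hx
  rw [hx, Pi.add_apply, add_mul]

theorem L2.integral_smul_mul {Ω : Set Plane} (c : ℂ) (u : L2 Ω) (ψ : Plane → ℂ) :
    ∫ x in Ω, (c • u : L2 Ω) x * ψ x = c * ∫ x in Ω, u x * ψ x := by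
  rw [← integral_const_mul]
  apply integral_congr_ae
  filter_upwards [Lp.coeFn_smul c u] with x hx
  simp [hx, mul_assoc]

theorem HasWeakPartial.add {Ω : Set Plane} {i : Fin 2} {u v g k : L2 Ω}
    (hu : HasWeakPartial Ω i u g) (hv : HasWeakPartial Ω i v k) :
    HasWeakPartial Ω i (u + v) (g + k) := by
  intro φ hφ
  rw [L2.integral_add_mul _ _ (hφ.memLp_partialDeriv i), L2.integral_add_mul _ _ hφ.memLp,
    hu φ hφ, hv φ hφ]
  ring

theorem HasWeakPartial.smul {Ω : Set Plane} {i : Fin 2} {u g : L2 Ω} (c : ℂ)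
    (hu : HasWeakPartial Ω i u g) : HasWeakPartial Ω i (c • u) (c • g) := by
  intro φ hφ
  rw [L2.integral_smul_mul, L2.integral_smul_mul, hu φ hφ]
  ring

theorem HasWeakPartial.zero (Ω : Set Plane) (i : Fin 2) : HasWeakPartial Ω i 0 0 := by
  simpa using HasWeakPartial.smul (Ω := Ω) (i := i) (u := 0) (g := 0) 0 (by
    intro φ _
    have h0 : ∀ ψ : Plane → ℂ, ∫ x in Ω, (0 : L2 Ω) x * ψ x = 0 := fun ψ => by
      simpa using L2.integral_smul_mul (0 : ℂ) (0 : L2 Ω) ψ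
    rw [h0, h0, neg_zero])

theorem partialDeriv_add {φ ψ : Plane → ℂ} (hφ : ContDiff ℝ ∞ φ) (hψ : ContDiff ℝ ∞ ψ)
    (i : Fin 2) : partialDeriv i (φ + ψ) = partialDeriv i φ + partialDeriv i ψ := by
  funext x
  simp only [partialDeriv, Pi.add_apply]
  rw [fderiv_add (hφ.differentiable (by simp) x) (hψ.differentiable (by simp) x)]
  rfl

theorem partialDeriv_smul {φ : Plane → ℂ} (c : ℂ) (hφ : ContDiff ℝ ∞ φ)
    (i : Fin 2) : partialDeriv i (c • φ) = c • partialDeriv i φ := by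
  funext x
  simp only [partialDeriv, Pi.smul_apply]
  rw [fderiv_const_smul (hφ.differentiable (by simp) x)]
  rfl

theorem L2.eLpNorm_add_sub_lt {Ω : Set Plane} (u v : L2 Ω) {φ ψ : Plane → ℂ}
    (hφ : MemLp φ 2 (volume.restrict Ω)) (hψ : MemLp ψ 2 (volume.restrict Ω)) {ε : ℝ≥0∞}
    (h1 : eLpNorm (fun x => u x - φ x) 2 (volume.restrict Ω) < ε / 2)
    (h2 : eLpNorm (fun x => v x - ψ x) 2 (volume.restrict Ω) < ε / 2) :
    eLpNorm (fun x => (u + v : L2 Ω) x - (φ + ψ) x) 2 (volume.restrict Ω) < ε := by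
  have he : (fun x => (u + v : L2 Ω) x - (φ + ψ) x) =ᵐ[volume.restrict Ω]
      ((fun x => u x - φ x) + fun x => v x - ψ x) := by
    filter_upwards [Lp.coeFn_add u v] with x hx
    simp only [hx, Pi.add_apply]
    ring
  rw [eLpNorm_congr_ae he]
  calc _ ≤ _ := eLpNorm_add_le ((Lp.memLp u).sub hφ).1 ((Lp.memLp v).sub hψ).1 (by norm_num)
    _ < ε / 2 + ε / 2 := ENNReal.add_lt_add h1 h2
    _ = ε := ENNReal.add_halves ε

theorem L2.eLpNorm_smul_sub {Ω : Set Plane} (c : ℂ) (u : L2 Ω) (φ : Plane → ℂ) :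
    eLpNorm (fun x => (c • u : L2 Ω) x - (c • φ) x) 2 (volume.restrict Ω) =
      ‖c‖ₑ * eLpNorm (fun x => u x - φ x) 2 (volume.restrict Ω) := by
  rw [← eLpNorm_const_smul]
  apply eLpNorm_congr_ae
  filter_upwards [Lp.coeFn_smul c u] with x hx
  simp [hx, mul_sub]

theorem MemH10.add {Ω : Set Plane} {u v : L2 Ω} (hu : MemH10 Ω u) (hv : MemH10 Ω v) :
    MemH10 Ω (u + v) := by
  obtain ⟨g, hg, hu⟩ := hu
  obtain ⟨k, hk, hv⟩ := hv
  refine ⟨g + k, fun i => (hg i).add (hk i), fun ε hε => ?_⟩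
  obtain ⟨φ, hφ, h1, h2⟩ := hu (ε / 2) (ENNReal.half_pos hε.ne')
  obtain ⟨ψ, hψ, h3, h4⟩ := hv (ε / 2) (ENNReal.half_pos hε.ne')
  refine ⟨φ + ψ, hφ.add hψ, L2.eLpNorm_add_sub_lt u v hφ.memLp hψ.memLp h1 h3, fun i => ?_⟩
  rw [partialDeriv_add hφ.smooth hψ.smooth]
  exact L2.eLpNorm_add_sub_lt (g i) (k i) (hφ.memLp_partialDeriv i) (hψ.memLp_partialDeriv i)
    (h2 i) (h4 i)

theorem MemH10.smul {Ω : Set Plane} {u : L2 Ω} (c : ℂ) (hu : MemH10 Ω u) :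
    MemH10 Ω (c • u) := by
  obtain ⟨g, hg, hu⟩ := hu
  refine ⟨c • g, fun i => (hg i).smul c, fun ε hε => ?_⟩
  have hlt : ∀ a : ℝ≥0∞, a < ε / (‖c‖ₑ + 1) → ‖c‖ₑ * a < ε := fun a ha => by
    have h1 : a * (‖c‖ₑ + 1) < ε := (ENNReal.lt_div_iff_mul_lt (by simp) (by simp)).1 ha
    refine lt_of_le_of_lt ?_ h1
    rw [mul_comm]
    gcongr
    exact le_self_add
  obtain ⟨φ, hφ, h1, h2⟩ := hu (ε / (‖c‖ₑ + 1)) (ENNReal.div_pos hε.ne' (by simp))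
  refine ⟨c • φ, hφ.smul c, ?_, fun i => ?_⟩
  · rw [L2.eLpNorm_smul_sub]
    exact hlt _ h1
  · rw [partialDeriv_smul c hφ.smooth, Pi.smul_apply, L2.eLpNorm_smul_sub]
    exact hlt _ (h2 i)

theorem MemH10.zero (Ω : Set Plane) : MemH10 Ω 0 := by
  refine ⟨0, fun i => HasWeakPartial.zero Ω i, fun ε hε => ⟨0, IsTestFunction.zero Ω, ?_, ?_⟩⟩
  · rw [show (fun x => (0 : L2 Ω) x - (0 : Plane → ℂ) x) = ((0 : L2 Ω) : Plane → ℂ) by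
      funext x; simp, eLpNorm_congr_ae (Lp.coeFn_zero ℂ 2 (volume.restrict Ω))]
    simpa using hε
  · intro i
    have hz : partialDeriv i (0 : Plane → ℂ) = 0 := by
      funext x
      simp [partialDeriv]
    rw [hz, show (fun x => (0 : Fin 2 → L2 Ω) i x - (0 : Plane → ℂ) x)
      = ((0 : L2 Ω) : Plane → ℂ) by funext x; simp,
      eLpNorm_congr_ae (Lp.coeFn_zero ℂ 2 (volume.restrict Ω))]
    simpa using hε

/-- The space of all `u ∈ H²(Ω) ∩ H¹₀(Ω)` with `Δ u + lam u = 0` in `Ω`. -/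
def dirichletEigenspace (Ω : Set Plane) (lam : ℝ) : Submodule ℂ (L2 Ω) where
  carrier := {u | SolvesDirichlet Ω lam u}
  zero_mem' := ⟨MemH10.zero Ω, 0, 0,
    ⟨fun i => HasWeakPartial.zero Ω i, fun _ j => HasWeakPartial.zero Ω j⟩, by simp⟩
  add_mem' := by
    rintro u v ⟨hu, g, h, hw, he⟩ ⟨hv, g', h', hw', he'⟩
    refine ⟨hu.add hv, g + g', h + h', ⟨fun i => (hw.first i).add (hw'.first i),
      fun i j => (hw.second i j).add (hw'.second i j)⟩, ?_⟩
    calc (h + h') 0 0 + (h + h') 1 1 + (lam : ℂ) • (u + v)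
        = (h 0 0 + h 1 1 + (lam : ℂ) • u) + (h' 0 0 + h' 1 1 + (lam : ℂ) • v) := by
          simp only [Pi.add_apply, smul_add]; abel
      _ = 0 := by rw [he, he', add_zero]
  smul_mem' := by
    rintro c u ⟨hu, g, h, hw, he⟩
    refine ⟨hu.smul c, c • g, c • h, ⟨fun i => (hw.first i).smul c,
      fun i j => (hw.second i j).smul c⟩, ?_⟩
    calc (c • h) 0 0 + (c • h) 1 1 + (lam : ℂ) • c • u
        = c • (h 0 0 + h 1 1 + (lam : ℂ) • u) := by
          simp only [Pi.smul_apply, smul_add, smul_comm (lam : ℂ) c u]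
      _ = 0 := by rw [he, smul_zero]

/-- `lam` is a Dirichlet eigenvalue of `Ω`. -/
def IsDirichletEigenvalue (Ω : Set Plane) (lam : ℝ) : Prop :=
  ∃ u ∈ dirichletEigenspace Ω lam, u ≠ 0

/-- The Dirichlet heat trace `∑_k exp (-λ_k t)`, the sum over all Dirichlet eigenvalues of `Ω`
counted with multiplicity, as an element of `[0, ∞]`. Numbers that are not eigenvalues have
multiplicity `0` and contribute nothing. -/
def dirichletHeatTrace (Ω : Set Plane) (t : ℝ) : ℝ≥0∞ :=
  ∑' lam : ℝ, (Cardinal.toENat (Module.rank ℂ (dirichletEigenspace Ω lam)) : ℝ≥0∞) *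
    ENNReal.ofReal (Real.exp (-lam * t))

/-! ### Theta functions -/

/-- `Θ₂(q) = ∑_{n ∈ ℤ} q ^ ((n + 1/2)²)`. -/
def Theta2 (q : ℝ) : ℝ := ∑' n : ℤ, q ^ (((n : ℝ) + 1 / 2) ^ 2)

/-- `Θ₃(q) = ∑_{n ∈ ℤ} q ^ (n²)`. -/
def Theta3 (q : ℝ) : ℝ := ∑' n : ℤ, q ^ ((n : ℝ) ^ 2)

/-- A series over `ℤ` of powers of `q ∈ (0, 1)` with exponents at least `|n| - 1` converges. -/
theorem summable_rpow_of_le {q : ℝ} (h0 : 0 < q) (h1 : q < 1) (e : ℤ → ℝ)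
    (he : ∀ n : ℤ, |(n : ℝ)| - 1 ≤ e n) : Summable fun n : ℤ => q ^ e n := by
  have hn : Summable fun n : ℕ => q ^ ((n : ℝ) - 1) := by
    have := (summable_geometric_of_lt_one h0.le h1).mul_right q⁻¹
    refine this.congr fun n => ?_
    rw [Real.rpow_sub h0, Real.rpow_natCast, Real.rpow_one, div_eq_mul_inv]
  have hz : Summable fun n : ℤ => q ^ (|(n : ℝ)| - 1) := by
    rw [summable_int_iff_summable_nat_and_neg]
    constructor <;> simpa using hn
  exact hz.of_nonneg_of_le (fun n => (Real.rpow_pos_of_pos h0 _).le)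
    fun n => Real.rpow_le_rpow_of_exponent_ge h0 h1.le (he n)

theorem summable_Theta2 {q : ℝ} (h0 : 0 < q) (h1 : q < 1) :
    Summable fun n : ℤ => q ^ (((n : ℝ) + 1 / 2) ^ 2) := by
  refine summable_rpow_of_le h0 h1 _ fun n => ?_
  rcases abs_cases (n : ℝ) with ⟨h, _⟩ | ⟨h, _⟩ <;> rw [h] <;> nlinarith [sq_nonneg ((n : ℝ) + 1)]

theorem summable_Theta3 {q : ℝ} (h0 : 0 < q) (h1 : q < 1) :
    Summable fun n : ℤ => q ^ ((n : ℝ) ^ 2) := by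
  refine summable_rpow_of_le h0 h1 _ fun n => ?_
  nlinarith [sq_nonneg (|(n : ℝ)| - 1), sq_abs (n : ℝ), abs_nonneg (n : ℝ)]

/-! ### Pinsky's conditions and orbits -/

/-- Pinsky's conditions (A), (B), (C), (D) on a pair of integers `(m, n)`. -/
structure PinskyConditions (p : ℤ × ℤ) : Prop where
  A : p.1 + p.2 ≡ 0 [ZMOD 3]
  B : p.1 ≠ 2 * p.2
  C : p.2 ≠ 2 * p.1
  D : p.1 ≠ -p.2

/-- The six pairs belonging to `(m, n)`. -/
def orbit (m n : ℤ) : Set (ℤ × ℤ) :=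
  {(-n, m - n), (-n, -m), (n - m, -m), (n - m, n), (m, n), (m, m - n)}

/-- The set of all orbits, each of whose pairs satisfies (A)-(D). -/
def admissibleOrbits : Set (Set (ℤ × ℤ)) :=
  {O | (∃ m n : ℤ, O = orbit m n) ∧ ∀ p ∈ O, PinskyConditions p}

end EquilateralTriangle

end

noncomputable section

namespace EquilateralTriangle

/-! The triangle is the fundamental alcove of the affine Weyl group of type A₂: in the coordinates
α, β of `simpleRoot` its sides are α = 0, β = 0 and α + β = 1. Antisymmetrizing the plane wave of a
weight over the finite Weyl group gives `altWave`, a Laplace eigenfunction because the group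
preserves the length of the weight. It vanishes on the first two sides by antisymmetry, and on the
third because the reflection there is a group element followed by a lattice translation, which the
waves do not see. A smooth function dominated by the distances to the sides lies in H¹₀
(`memH10_triangle`). Weights in the open chamber, indexed by pairs of positive integers, give
linearly independent eigenfunctions: distinct characters are independent, and a relation on the
triangle extends to the plane by analyticity.

That nothing else occurs rests on `eq_zero_of_integral_mul_altWave`. If u pairs to zero with every
`altWave`, the functional F ↦ Σ sgn(w) ∫ u F(w x) on continuous functions on the torus kills all
Fourier monomials, hence every F. Take for F the periodization of a test function φ of the triangle:
the other images of the alcove are disjoint from it, so only w = 1 contributes and ∫ u φ = 0. By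
Green's identity an eigenfunction is orthogonal to every `altWave` of different energy, so it is
determined by its pairings with those of its own energy; this bounds the multiplicity
(`rank_dirichletEigenspace_triangle`).

The heat trace is then a sum over the pairs. The theta formula comes from summing over the hexagonal
lattice in two ways: by its six-fold symmetry, and by completing the square after splitting one
coordinate by parity. The orbits O(a, b) are the same Weyl orbits in the coordinates a = 2m + n, b =
m + 2n; (B)-(D) exclude the walls and (A) makes m and n integers. -/

/-! ### Orbits and the open Weyl chamber -/

theorem orbit_quadraticForm {m n : ℤ} {p : ℤ × ℤ} (hp : p ∈ orbit (2 * m + n) (m + 2 * n)) :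
    p.1 ^ 2 - p.1 * p.2 + p.2 ^ 2 = 3 * (m ^ 2 + m * n + n ^ 2) := by
  simp only [orbit, Set.mem_insert_iff, Set.mem_singleton_iff] at hp
  rcases hp with rfl | rfl | rfl | rfl | rfl | rfl <;> ring

theorem orbit_mem_admissibleOrbits {m n : ℤ} (hm : 0 < m) (hn : 0 < n) :
    orbit (2 * m + n) (m + 2 * n) ∈ admissibleOrbits := by
  refine ⟨⟨_, _, rfl⟩, fun p hp => ?_⟩
  simp only [orbit, Set.mem_insert_iff, Set.mem_singleton_iff] at hp
  rcases hp with rfl | rfl | rfl | rfl | rfl | rfl <;>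
    exact ⟨by simp only [Int.ModEq]; omega, by simp only; omega, by simp only; omega,
      by simp only; omega⟩

/-- An orbit meets the open chamber in at most one pair: of the six possible identifications,
positivity leaves only the trivial one. -/
theorem orbit_injective {m n m' n' : ℤ} (hm : 0 < m) (hn : 0 < n) (hm' : 0 < m') (hn' : 0 < n')
    (h : orbit (2 * m + n) (m + 2 * n) = orbit (2 * m' + n') (m' + 2 * n')) :
    m = m' ∧ n = n' := by
  have h1 : (2 * m + n, m + 2 * n) ∈ orbit (2 * m' + n') (m' + 2 * n') := by
    rw [← h]
    simp [orbit]
  simp only [orbit, Set.mem_insert_iff, Set.mem_singleton_iff, Prod.mk.injEq] at h1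
  omega

theorem mem_orbit_trans {a b : ℤ} {p q : ℤ × ℤ} (hp : p ∈ orbit a b) (hq : q ∈ orbit p.1 p.2) :
    q ∈ orbit a b := by
  simp only [orbit, Set.mem_insert_iff, Set.mem_singleton_iff] at hp hq ⊢
  rcases hp with rfl | rfl | rfl | rfl | rfl | rfl <;>
    rcases hq with rfl | rfl | rfl | rfl | rfl | rfl <;> simp <;> omega

theorem mem_orbit_symm {a b : ℤ} {p : ℤ × ℤ} (hp : p ∈ orbit a b) : (a, b) ∈ orbit p.1 p.2 := by
  simp only [orbit, Set.mem_insert_iff, Set.mem_singleton_iff] at hp ⊢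
  rcases hp with rfl | rfl | rfl | rfl | rfl | rfl <;> simp

theorem orbit_eq_of_mem {a b : ℤ} {p : ℤ × ℤ} (hp : p ∈ orbit a b) :
    orbit p.1 p.2 = orbit a b :=
  Set.Subset.antisymm (fun _ hq => mem_orbit_trans hp hq)
    fun _ hq => mem_orbit_trans (mem_orbit_symm hp) hq

/-- An orbit off the walls contains a pair in the open Weyl chamber. -/
theorem exists_mem_orbit_dominant {a b : ℤ} (h1 : a ≠ 2 * b) (h2 : b ≠ 2 * a) (h3 : a ≠ -b) :
    ∃ p ∈ orbit a b, 0 < 2 * p.1 - p.2 ∧ 0 < 2 * p.2 - p.1 := by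
  simp only [orbit, Set.mem_insert_iff, Set.mem_singleton_iff, exists_eq_or_imp, exists_eq_left]
  omega

theorem exists_of_mem_admissibleOrbits {O : Set (ℤ × ℤ)} (hO : O ∈ admissibleOrbits) :
    ∃ m n : ℤ, 0 < m ∧ 0 < n ∧ orbit (2 * m + n) (m + 2 * n) = O := by
  obtain ⟨⟨a, b, rfl⟩, h⟩ := hO
  obtain ⟨-, hB, hC, hD⟩ := h (a, b) (by simp [orbit])
  obtain ⟨p, hp, h1, h2⟩ := exists_mem_orbit_dominant hB hC hD
  have hA := (h p hp).A
  simp only [Int.ModEq] at hA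
  -- These solve 2m + n = p.1, m + 2n = p.2. Both numerators are congruent to 2 (p.1 + p.2) modulo
  -- 3, so (A) makes the divisions exact.
  refine ⟨(2 * p.1 - p.2) / 3, (2 * p.2 - p.1) / 3, by omega, by omega, ?_⟩
  rw [← orbit_eq_of_mem hp]
  congr 1 <;> omega

theorem bijOn_orbit : Set.BijOn (fun p : ℕ+ × ℕ+ => orbit (2 * p.1 + p.2) (p.1 + 2 * p.2))
    Set.univ admissibleOrbits := by
  refine ⟨fun p _ => orbit_mem_admissibleOrbits (by simp) (by simp), ?_, ?_⟩
  · rintro ⟨m, n⟩ - ⟨m', n'⟩ - h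
    have := orbit_injective (by simp) (by simp) (by simp) (by simp) h
    ext <;> exact_mod_cast by simp_all
  · rintro O hO
    obtain ⟨m, n, hm, hn, rfl⟩ := exists_of_mem_admissibleOrbits hO
    lift m to ℕ using hm.le
    lift n to ℕ using hn.le
    exact ⟨(⟨m, by omega⟩, ⟨n, by omega⟩), trivial, rfl⟩

/-! ### The theta series of the hexagonal lattice -/

theorem tsum_int_eq_zero_add_tsum_pnat (g : ℤ → ℝ≥0∞) :
    ∑' n : ℤ, g n = g 0 + ((∑' n : ℕ+, g n) + ∑' n : ℕ+, g (-n)) := by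
  have h1 : ∀ f : ℕ → ℝ≥0∞, ∑' n : ℕ+, f n = ∑' n : ℕ, f (n + 1) := fun f =>
    tsum_pnat_eq_tsum_succ
  rw [tsum_of_nat_of_neg_add_one ENNReal.summable ENNReal.summable,
    tsum_eq_zero_add' ENNReal.summable, add_assoc, h1 (fun n => g n), h1 (fun n => g (-n))]
  simp

/-- Splitting a double series over positive integers along the diagonal. -/
theorem tsum_pnat_pnat_eq_diag (g : ℕ+ → ℕ+ → ℝ≥0∞) :
    ∑' (m : ℕ+) (n : ℕ+), g m n =
      (∑' n, g n n) + ((∑' (n : ℕ+) (j : ℕ+), g (n + j) n) + ∑' (n : ℕ+) (j : ℕ+), g n (n + j)) := by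
  let e : ℕ+ ⊕ (ℕ+ × ℕ+) ⊕ (ℕ+ × ℕ+) → ℕ+ × ℕ+ :=
    Sum.elim (fun n => (n, n)) (Sum.elim (fun p => (p.1 + p.2, p.1)) (fun p => (p.1, p.1 + p.2)))
  have he : Function.Bijective e := by
    constructor
    · rintro (a | ⟨a, b⟩ | ⟨a, b⟩) (c | ⟨c, d⟩ | ⟨c, d⟩) h <;>
        simp only [e, Sum.elim_inl, Sum.elim_inr, Prod.mk.injEq, ← PNat.coe_inj, PNat.add_coe] at h <;>
        simp only [Sum.inl.injEq, Sum.inr.injEq, Prod.mk.injEq, ← PNat.coe_inj, reduceCtorEq] <;>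
        have := a.pos <;> have := c.pos <;> (try have := b.pos) <;> (try have := d.pos) <;> omega
    · rintro ⟨m, n⟩
      rcases lt_trichotomy m n with h | rfl | h
      · exact ⟨.inr (.inr (m, n - m)), by simp [e, PNat.add_sub_of_lt h]⟩
      · exact ⟨.inl m, rfl⟩
      · exact ⟨.inr (.inl (n, m - n)), by simp [e, PNat.add_sub_of_lt h]⟩
  rw [← ENNReal.tsum_prod, ← (Equiv.ofBijective e he).tsum_eq,
    Summable.tsum_sum ENNReal.summable ENNReal.summable,
    Summable.tsum_sum ENNReal.summable ENNReal.summable,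
    ← ENNReal.tsum_prod, ← ENNReal.tsum_prod]
  rfl

/-- The axes are four of the six rays, and the two quadrants of equal signs are two of the six
sectors. In each mixed quadrant the form is m² - mn + n²: its diagonal is another ray, and the
substitution m = n + j (or n = m + j) turns each half into a full sector. -/
theorem tsum_int_int_hexagonal (x : ℕ → ℝ≥0∞) :
    ∑' (m : ℤ) (n : ℤ), x (m ^ 2 + m * n + n ^ 2).toNat =
      x 0 + 6 * (∑' n : ℕ+, x (n ^ 2)) + 6 * ∑' (m : ℕ+) (n : ℕ+), x (m ^ 2 + m * n + n ^ 2) := by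
  have hd : ∀ m n : ℕ+, ((m : ℤ) ^ 2 + m * -n + (-n : ℤ) ^ 2).toNat =
      ((-m : ℤ) ^ 2 + -m * n + (n : ℤ) ^ 2).toNat := fun m n => by congr 1; ring
  have hpp : ∀ m n : ℕ+, ((m : ℤ) ^ 2 + m * n + (n : ℤ) ^ 2).toNat =
      (m ^ 2 + m * n + n ^ 2 : ℕ) := fun m n => by
    rw [← Int.toNat_natCast (m ^ 2 + m * n + n ^ 2 : ℕ)]; push_cast; rfl
  have hmm : ∀ m n : ℕ+, ((-m : ℤ) ^ 2 + -m * -n + (-n : ℤ) ^ 2).toNat =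
      (m ^ 2 + m * n + n ^ 2 : ℕ) := fun m n => by
    rw [← hpp]; congr 1; ring
  have hp0 : ∀ m : ℕ+, ((m : ℤ) ^ 2).toNat = (m ^ 2 : ℕ) := fun m => by
    rw [← Int.toNat_natCast (m ^ 2 : ℕ)]; push_cast; rfl
  have hmix : ∑' (m : ℕ+) (n : ℕ+), x ((-m : ℤ) ^ 2 + -m * n + (n : ℤ) ^ 2).toNat =
      (∑' n : ℕ+, x (n ^ 2)) + 2 * ∑' (m : ℕ+) (n : ℕ+), x (m ^ 2 + m * n + n ^ 2) := by
    rw [tsum_pnat_pnat_eq_diag, two_mul]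
    congr 1
    · refine tsum_congr fun n => ?_
      rw [← hp0]; congr 2; ring
    · congr 1 <;> refine tsum_congr fun n => tsum_congr fun j => ?_ <;>
        rw [← hpp] <;> congr 2 <;> push_cast <;> ring
  rw [tsum_int_eq_zero_add_tsum_pnat]
  simp_rw [tsum_int_eq_zero_add_tsum_pnat (fun n : ℤ => x (_ + _ * n + n ^ 2).toNat)]
  simp only [ENNReal.tsum_add, hd, hpp, hmm, hmix]
  simp only [ne_eq, OfNat.ofNat_ne_zero, not_false_eq_true, zero_pow, zero_mul, mul_zero, add_zero,
    zero_add, Int.toNat_zero, even_two, Even.neg_pow, hp0]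
  ring

theorem ofReal_Theta3 {q : ℝ} (h0 : 0 < q) (h1 : q < 1) :
    ENNReal.ofReal (Theta3 q) = ∑' n : ℤ, ENNReal.ofReal (q ^ ((n : ℝ) ^ 2)) :=
  ENNReal.ofReal_tsum_of_nonneg (fun _ => by positivity) (summable_Theta3 h0 h1)

theorem ofReal_Theta2 {q : ℝ} (h0 : 0 < q) (h1 : q < 1) :
    ENNReal.ofReal (Theta2 q) = ∑' n : ℤ, ENNReal.ofReal (q ^ (((n : ℝ) + 1 / 2) ^ 2)) :=
  ENNReal.ofReal_tsum_of_nonneg (fun _ => by positivity) (summable_Theta2 h0 h1)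

theorem tsum_int_eq_even_add_odd (g : ℤ → ℝ≥0∞) :
    ∑' n : ℤ, g n = (∑' k : ℤ, g (2 * k)) + ∑' k : ℤ, g (2 * k + 1) := by
  let e : ℤ ⊕ ℤ → ℤ := Sum.elim (fun k => 2 * k) (fun k => 2 * k + 1)
  have he : Function.Bijective e := by
    constructor
    · rintro (a | a) (b | b) h <;> simp only [e, Sum.elim_inl, Sum.elim_inr] at h <;>
        simp only [Sum.inl.injEq, Sum.inr.injEq, reduceCtorEq] <;> omega
    · intro n
      rcases Int.even_or_odd' n with ⟨k, rfl | rfl⟩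
      · exact ⟨.inl k, rfl⟩
      · exact ⟨.inr k, rfl⟩
  rw [← (Equiv.ofBijective e he).tsum_eq, Summable.tsum_sum ENNReal.summable ENNReal.summable]
  rfl

/-- The theta series of the hexagonal lattice. -/
theorem tsum_hexagonal_eq_theta {q : ℝ} (h0 : 0 < q) (h1 : q < 1) :
    ∑' (m : ℤ) (n : ℤ), ENNReal.ofReal ((q ^ 3) ^ (m ^ 2 + m * n + n ^ 2).toNat) =
      ENNReal.ofReal (Theta3 (q ^ 3) * Theta3 (q ^ 9) + Theta2 (q ^ 3) * Theta2 (q ^ 9)) := by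
  have h3 : q ^ 3 < 1 := pow_lt_one₀ h0.le h1 (by simp)
  have h9 : q ^ 9 < 1 := pow_lt_one₀ h0.le h1 (by simp)
  have hT3 : ∀ p : ℝ, 0 < p → 0 ≤ Theta3 p := fun p hp => tsum_nonneg fun n => by positivity
  have hT2 : ∀ p : ℝ, 0 < p → 0 ≤ Theta2 p := fun p hp => tsum_nonneg fun n => by positivity
  have p3 : 0 < q ^ 3 := by positivity
  have p9 : 0 < q ^ 9 := by positivity
  have key : ∀ m n : ℤ, (q ^ 3) ^ (m ^ 2 + m * n + n ^ 2).toNat =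
      q ^ (3 * ((m : ℝ) ^ 2 + m * n + n ^ 2)) := fun m n => by
    have hn : 0 ≤ m ^ 2 + m * n + n ^ 2 := by nlinarith [sq_nonneg (m + n), sq_nonneg m, sq_nonneg n]
    have : (((m ^ 2 + m * n + n ^ 2).toNat : ℕ) : ℝ) = (m : ℝ) ^ 2 + m * n + n ^ 2 := by
      rw [← Int.cast_natCast, Int.toNat_of_nonneg hn]; push_cast; rfl
    rw [← pow_mul, ← Real.rpow_natCast, Nat.cast_mul, this]; norm_cast
  rw [ENNReal.ofReal_add (mul_nonneg (hT3 _ p3) (hT3 _ p9)) (mul_nonneg (hT2 _ p3) (hT2 _ p9)),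
    ENNReal.ofReal_mul (hT3 _ p3), ENNReal.ofReal_mul (hT2 _ p3), ofReal_Theta3 p3 h3,
    ofReal_Theta3 p9 h9, ofReal_Theta2 p3 h3, ofReal_Theta2 p9 h9]
  -- Complete the square by parity of n: for n = 2k the form is (m + k)² + 3k², for n = 2k + 1 it is
  -- (m + k + 1/2)² + 3 (k + 1/2)². The shift of m by k is the `Equiv.addRight k` below.
  rw [ENNReal.tsum_comm, tsum_int_eq_even_add_odd]
  rw [← ENNReal.tsum_mul_left, ← ENNReal.tsum_mul_left]
  congr 1
  all_goals
    refine tsum_congr fun k => ?_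
    symm
    rw [← ENNReal.tsum_mul_right, ← (Equiv.addRight k).tsum_eq]
    refine tsum_congr fun m => ?_
    symm
    rw [key, Equiv.coe_addRight, ← ENNReal.ofReal_mul (by positivity)]
    congr 1
    rw [← Real.rpow_natCast q 3, ← Real.rpow_natCast q 9, ← Real.rpow_mul h0.le,
      ← Real.rpow_mul h0.le, ← Real.rpow_add h0]
    congr 1
    push_cast
    ring

theorem tsum_pnat_pnat_eq_theta {q : ℝ} (h0 : 0 < q) (h1 : q < 1) :
    ∑' (m : ℕ+) (n : ℕ+), ENNReal.ofReal ((q ^ 3) ^ (m ^ 2 + m * n + n ^ 2 : ℕ)) =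
      ENNReal.ofReal ((Theta3 (q ^ 3) * Theta3 (q ^ 9) + Theta2 (q ^ 3) * Theta2 (q ^ 9)
        - 3 * Theta3 (q ^ 3) + 2) / 6) := by
  have h3 : q ^ 3 < 1 := pow_lt_one₀ h0.le h1 (by simp)
  have p3 : 0 < q ^ 3 := by positivity
  set S := ∑' (m : ℕ+) (n : ℕ+), ENNReal.ofReal ((q ^ 3) ^ (m ^ 2 + m * n + n ^ 2 : ℕ)) with hS
  set a := ∑' n : ℕ+, ENNReal.ofReal ((q ^ 3) ^ (n ^ 2 : ℕ)) with ha
  have e1 := tsum_hexagonal_eq_theta h0 h1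
  rw [tsum_int_int_hexagonal (fun k => ENNReal.ofReal ((q ^ 3) ^ k)), ← hS, ← ha] at e1
  have e2 : ENNReal.ofReal (Theta3 (q ^ 3)) = 1 + 2 * a := by
    have : ∀ n : ℕ+, (q ^ 3) ^ ((n : ℝ) ^ 2) = (q ^ 3) ^ (n ^ 2 : ℕ) := fun n => by
      rw [← Real.rpow_natCast (q ^ 3) (n ^ 2 : ℕ)]; push_cast; rfl
    rw [ofReal_Theta3 p3 h3, tsum_int_eq_zero_add_tsum_pnat, two_mul]
    simp [this, ha]
  have hT3 : 0 ≤ Theta3 (q ^ 3) := tsum_nonneg fun n => by positivity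
  -- With S and a finite, `e1` and `e2` become real equations: the lattice sum is 1 + 6a + 6S, and
  -- Θ₃(q³) = 1 + 2a. Eliminating a gives the formula for S.
  have hfin : S ≠ ⊤ := fun h => by simp [h] at e1
  have hafin : a ≠ ⊤ := fun h => by simp [h] at e2
  rw [← ENNReal.ofReal_toReal hfin]
  have hsum : 0 ≤ Theta3 (q ^ 3) * Theta3 (q ^ 9) + Theta2 (q ^ 3) * Theta2 (q ^ 9) :=
    add_nonneg (mul_nonneg hT3 (tsum_nonneg fun n => by positivity))
      (mul_nonneg (tsum_nonneg fun n => by positivity) (tsum_nonneg fun n => by positivity))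
  have e3 := congrArg ENNReal.toReal e1
  have e4 := congrArg ENNReal.toReal e2
  rw [ENNReal.toReal_ofReal hT3, ENNReal.toReal_add (by simp) (by finiteness),
    ENNReal.toReal_mul] at e4
  rw [ENNReal.toReal_ofReal hsum, ENNReal.toReal_add (by finiteness) (by finiteness),
    ENNReal.toReal_add (by finiteness) (by finiteness), ENNReal.toReal_mul,
    ENNReal.toReal_mul] at e3
  simp only [pow_zero, ENNReal.ofReal_one, ENNReal.toReal_one, ENNReal.toReal_ofNat] at e3 e4
  congr 1
  linarith

/-! ### Square-integrable functions and weak derivatives -/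

theorem enorm_integral_mul_le {α : Type*} [MeasurableSpace α] {μ : Measure α} {f g : α → ℂ}
    (hf : AEStronglyMeasurable f μ) (hg : AEStronglyMeasurable g μ) :
    ‖∫ x, f x * g x ∂μ‖ₑ ≤ eLpNorm f 2 μ * eLpNorm g 2 μ := by
  calc ‖∫ x, f x * g x ∂μ‖ₑ ≤ ∫⁻ x, ‖f x * g x‖ₑ ∂μ := enorm_integral_le_lintegral_enorm _
    _ = eLpNorm (f • g) 1 μ := by rw [eLpNorm_one_eq_lintegral_enorm]; rfl
    _ ≤ _ := eLpNorm_smul_le_mul_eLpNorm hg hf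

/-- Bounded convergence in `L²` of a finite measure. -/
theorem tendsto_eLpNorm_zero_of_bounded {α : Type*} [MeasurableSpace α] {μ : Measure α}
    [IsFiniteMeasure μ] {f : ℕ → α → ℂ} (hf : ∀ k, AEStronglyMeasurable (f k) μ) {C : ℝ}
    (hC : ∀ k, ∀ᵐ x ∂μ, ‖f k x‖ ≤ C)
    (hlim : ∀ᵐ x ∂μ, ∀ᶠ k in Filter.atTop, f k x = 0) :
    Filter.Tendsto (fun k => eLpNorm (f k) 2 μ) Filter.atTop (nhds 0) := by
  have h1 : Filter.Tendsto (fun k => ∫⁻ x, ‖f k x‖ₑ ^ (2 : ℝ) ∂μ) Filter.atTop (nhds 0) := by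
    rw [← lintegral_zero (μ := μ)]
    refine tendsto_lintegral_of_dominated_convergence' (fun _ => ENNReal.ofReal C ^ (2 : ℝ))
      (fun k => (hf k).enorm.pow_const _) (fun k => ?_) ?_ ?_
    · filter_upwards [hC k] with x hx
      gcongr
      rw [← ofReal_norm]
      exact ENNReal.ofReal_le_ofReal hx
    · rw [lintegral_const]
      exact ENNReal.mul_ne_top (by finiteness) (measure_ne_top _ _)
    · filter_upwards [hlim] with x hx
      exact tendsto_const_nhds.congr' (by filter_upwards [hx] with k hk; simp [hk])
  have h2 := ((ENNReal.continuous_rpow_const (y := 1 / 2)).tendsto 0).comp h1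
  simp only [Function.comp_def] at h2
  rw [ENNReal.zero_rpow_of_pos (by norm_num)] at h2
  refine h2.congr fun k => ?_
  rw [eLpNorm_eq_lintegral_rpow_enorm_toReal (by simp) (by simp)]
  simp

theorem contDiff_partialDeriv {f : Plane → ℂ} (hf : ContDiff ℝ ∞ f) (i : Fin 2) :
    ContDiff ℝ ∞ (partialDeriv i f) :=
  (hf.fderiv_right (by simp)).clm_apply contDiff_const

theorem IsTestFunction.partialDeriv {Ω : Set Plane} {φ : Plane → ℂ} (hφ : IsTestFunction Ω φ)
    (i : Fin 2) : IsTestFunction Ω (partialDeriv i φ) := by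
  have hs : tsupport (EquilateralTriangle.partialDeriv i φ) ⊆ tsupport φ := by
    refine (closure_mono fun x hx => ?_).trans (tsupport_fderiv_subset ℝ (f := φ))
    simp only [EquilateralTriangle.partialDeriv, Function.mem_support] at hx ⊢
    exact fun h => hx (by simp [h])
  exact ⟨contDiff_partialDeriv hφ.smooth i,
    hφ.compactSupport.of_isClosed_subset (isClosed_tsupport _) hs,
    hs.trans hφ.support_subset⟩

theorem setIntegral_mul_partialDeriv {Ω : Set Plane} {f φ : Plane → ℂ} (hf : ContDiff ℝ ∞ f)
    (hφ : IsTestFunction Ω φ) (i : Fin 2) :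
    ∫ x in Ω, f x * partialDeriv i φ x = -∫ x in Ω, partialDeriv i f x * φ x := by
  have hz : ∀ ψ : Plane → ℂ, IsTestFunction Ω ψ → ∀ h : Plane → ℂ,
      ∫ x in Ω, h x * ψ x = ∫ x, h x * ψ x := fun ψ hψ h =>
    setIntegral_eq_integral_of_forall_compl_eq_zero fun x hx => by
      rw [image_eq_zero_of_notMem_tsupport fun hx' => hx (hψ.support_subset hx'), mul_zero]
  have hi : ∀ ψ : Plane → ℂ, IsTestFunction Ω ψ → ∀ h : Plane → ℂ, Continuous h →
      Integrable fun x => h x * ψ x := fun ψ hψ h hh =>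
    (hh.mul hψ.smooth.continuous).integrable_of_hasCompactSupport hψ.compactSupport.mul_left
  rw [hz _ (hφ.partialDeriv i), hz _ hφ]
  exact integral_mul_fderiv_eq_neg_fderiv_mul_of_integrable
    (hi _ hφ _ (contDiff_partialDeriv hf i).continuous) (hi _ (hφ.partialDeriv i) _ hf.continuous)
    (hi _ hφ _ hf.continuous) (fun x _ => hf.differentiable (by simp) x)
    fun x _ => hφ.smooth.differentiable (by simp) x

theorem integral_toLp_mul {Ω : Set Plane} {f : Plane → ℂ} (hf : MemLp f 2 (volume.restrict Ω))
    (g : Plane → ℂ) : ∫ x in Ω, hf.toLp f x * g x = ∫ x in Ω, f x * g x :=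
  integral_congr_ae (by filter_upwards [hf.coeFn_toLp] with x hx; rw [hx])

theorem hasWeakPartial_toLp {Ω : Set Plane} {f : Plane → ℂ} (hf : ContDiff ℝ ∞ f) (i : Fin 2)
    (h0 : MemLp f 2 (volume.restrict Ω)) (h1 : MemLp (partialDeriv i f) 2 (volume.restrict Ω)) :
    HasWeakPartial Ω i (h0.toLp f) (h1.toLp _) := fun φ hφ => by
  rw [integral_toLp_mul, integral_toLp_mul]
  exact setIntegral_mul_partialDeriv hf hφ i

/-- The fundamental lemma of the calculus of variations. -/
theorem L2.eq_zero_of_forall_testFunction {Ω : Set Plane} (hΩ : IsOpen Ω) (u : L2 Ω)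
    (h : ∀ φ, IsTestFunction Ω φ → ∫ x in Ω, u x * φ x = 0) : u = 0 := by
  have hae := hΩ.ae_eq_zero_of_integral_contDiff_smul_eq_zero (f := u) (μ := volume) ?_ ?_
  · rw [← ae_restrict_iff' hΩ.measurableSet] at hae
    exact (Lp.eq_zero_iff_ae_eq_zero).2 hae
  · exact locallyIntegrableOn_of_locallyIntegrable_restrict
      ((Lp.memLp u).locallyIntegrable (by norm_num))
  · intro g hg hc hs
    have hsub : Function.support (fun x => (g x : ℂ)) = Function.support g := by
      ext x; simp
    have ht : IsTestFunction Ω fun x => (g x : ℂ) :=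
      ⟨Complex.ofRealCLM.contDiff.comp hg, by simpa [HasCompactSupport, tsupport, hsub] using hc,
        by simpa [tsupport, hsub] using hs⟩
    rw [← h _ ht, eq_comm]
    rw [setIntegral_eq_integral_of_forall_compl_eq_zero]
    · simp [mul_comm]
    · intro x hx
      rw [image_eq_zero_of_notMem_tsupport fun hx' => hx (ht.support_subset hx'), mul_zero]

theorem HasWeakPartial.unique {Ω : Set Plane} (hΩ : IsOpen Ω) {i : Fin 2} {u g k : L2 Ω}
    (hg : HasWeakPartial Ω i u g) (hk : HasWeakPartial Ω i u k) : g = k := by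
  have h0 := (hg.smul (-1)).add hk
  have : g - k = 0 := L2.eq_zero_of_forall_testFunction hΩ _ fun φ hφ => by
    rw [show g - k = g + (-1 : ℂ) • k by rw [neg_one_smul, sub_eq_add_neg],
      L2.integral_add_mul _ _ hφ.memLp, L2.integral_smul_mul]
    have h1 := hg φ hφ
    rw [hk φ hφ] at h1
    linear_combination h1
  exact sub_eq_zero.1 this

/-- Integration by parts against a function in `H¹₀(Ω)`. -/
theorem MemH10.integral_mul_weakPartial {Ω : Set Plane} (hΩ : IsOpen Ω) {u g w z : L2 Ω}
    {i : Fin 2} (hu : MemH10 Ω u) (hg : HasWeakPartial Ω i u g) (hw : HasWeakPartial Ω i w z) :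
    ∫ x in Ω, w x * g x = -∫ x in Ω, z x * u x := by
  obtain ⟨g', hg', happ⟩ := hu
  -- The gradient supplied by membership in H¹₀ is the given one, so the approximation applies to g
  -- itself.
  obtain rfl := (hg' i).unique hΩ hg
  rw [← add_eq_zero_iff_eq_neg, ← enorm_eq_zero]
  set K := eLpNorm w 2 (volume.restrict Ω) + eLpNorm z 2 (volume.restrict Ω) with hK
  have hKt : K ≠ ⊤ := ENNReal.add_ne_top.2 ⟨Lp.eLpNorm_ne_top w, Lp.eLpNorm_ne_top z⟩
  have hlim : Filter.Tendsto (fun ε => K * ε) (nhdsWithin 0 (Set.Ioi 0)) (nhds 0) := by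
    have := ((ENNReal.continuous_const_mul hKt).tendsto 0).mono_left
      (nhdsWithin_le_nhds (s := Set.Ioi 0))
    rwa [mul_zero] at this
  -- For test functions the identity is the definition of a weak derivative. Replacing u by an
  -- ε-close test function costs at most K ε by Cauchy-Schwarz.
  refine le_antisymm (ge_of_tendsto hlim ?_) zero_le
  filter_upwards [self_mem_nhdsWithin] with ε hε
  obtain ⟨φ, hφ, h1, h2⟩ := happ ε hε
  have e1 : ∫ x in Ω, w x * (g' i x - partialDeriv i φ x) =
      (∫ x in Ω, w x * g' i x) - ∫ x in Ω, w x * partialDeriv i φ x := by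
    simp_rw [mul_sub]
    exact integral_sub (L2.integrable_mul w (Lp.memLp _))
      (L2.integrable_mul w (hφ.memLp_partialDeriv i))
  have e2 : ∫ x in Ω, z x * (u x - φ x) =
      (∫ x in Ω, z x * u x) - ∫ x in Ω, z x * φ x := by
    simp_rw [mul_sub]
    exact integral_sub (L2.integrable_mul z (Lp.memLp _)) (L2.integrable_mul z hφ.memLp)
  have e3 : (∫ x in Ω, w x * g' i x) + ∫ x in Ω, z x * u x =
      (∫ x in Ω, w x * (g' i x - partialDeriv i φ x)) + ∫ x in Ω, z x * (u x - φ x) := by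
    rw [e1, e2, hw φ hφ]
    ring
  rw [e3, hK, add_mul]
  refine (enorm_add_le _ _).trans (add_le_add ?_ ?_)
  · refine (enorm_integral_mul_le (Lp.aestronglyMeasurable w)
      ((Lp.memLp _).sub (hφ.memLp_partialDeriv i)).1).trans ?_
    gcongr
    exact (h2 i).le
  · refine (enorm_integral_mul_le (Lp.aestronglyMeasurable z)
      ((Lp.memLp _).sub hφ.memLp).1).trans ?_
    gcongr
    exact h1.le

/-- Eigenfunctions to different eigenvalues are orthogonal for the bilinear pairing. -/
theorem SolvesDirichlet.integral_mul_eq_zero {Ω : Set Plane} (hΩ : IsOpen Ω) {a b : ℝ}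
    (hab : a ≠ b) {u v : L2 Ω} (hu : SolvesDirichlet Ω a u) (hv : SolvesDirichlet Ω b v) :
    ∫ x in Ω, u x * v x = 0 := by
  obtain ⟨hu0, g, h, hgh, he⟩ := hu
  obtain ⟨hv0, k, l, hkl, he'⟩ := hv
  have key : ∀ {c : ℝ} {w y : L2 Ω} {h : Fin 2 → Fin 2 → L2 Ω},
      h 0 0 + h 1 1 + (c : ℂ) • w = 0 →
      (∫ x in Ω, h 0 0 x * y x) + (∫ x in Ω, h 1 1 x * y x) = -(c * ∫ x in Ω, w x * y x) := by
    intro c w y h he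
    rw [← L2.integral_smul_mul, ← L2.integral_add_mul _ _ (Lp.memLp y), ← add_eq_zero_iff_eq_neg,
      ← L2.integral_add_mul _ _ (Lp.memLp y), he]
    simpa using L2.integral_smul_mul (0 : ℂ) (0 : L2 Ω) y
  -- Green's identity: both sides equal minus the integral of the product of the i-th derivatives of
  -- u and v, one by v ∈ H¹₀ and the other by u ∈ H¹₀.
  have h1 : ∀ i, ∫ x in Ω, h i i x * v x = ∫ x in Ω, l i i x * u x := fun i => by
    rw [← neg_inj, ← hv0.integral_mul_weakPartial hΩ (hkl.first i) (hgh.second i i),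
      ← hu0.integral_mul_weakPartial hΩ (hgh.first i) (hkl.second i i)]
    simp_rw [mul_comm]
  have h2 := key (y := v) he
  rw [h1, h1, key he', neg_inj] at h2
  simp_rw [mul_comm (v _)] at h2
  have h3 : ((a : ℂ) - b) * ∫ x in Ω, u x * v x = 0 := by linear_combination -h2
  exact (mul_eq_zero.1 h3).resolve_left (sub_ne_zero.2 (by exact_mod_cast hab))

/-! ### Cutoff functions and membership in `H¹₀` -/

/-- A sequence of smooth cutoff functions in `Ω`, compatible with multiplication by `f`. -/
structure IsCutoff (Ω : Set Plane) (f : Plane → ℂ) (η : ℕ → Plane → ℝ) : Prop where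
  smooth : ∀ k, ContDiff ℝ ∞ (η k)
  abs_le_one : ∀ k x, |η k x| ≤ 1
  bound : ∃ C : ℝ, ∀ k, ∀ x ∈ Ω, ∀ i : Fin 2,
    ‖f x‖ * |fderiv ℝ (η k) x (EuclideanSpace.single i 1)| ≤ C
  eventually_one : ∀ x ∈ Ω, ∀ᶠ k in Filter.atTop, η k =ᶠ[nhds x] 1

theorem IsCutoff.mul {Ω : Set Plane} {f : Plane → ℂ} {η θ : ℕ → Plane → ℝ}
    (hη : IsCutoff Ω f η) (hθ : IsCutoff Ω f θ) : IsCutoff Ω f fun k x => η k x * θ k x where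
  smooth k := (hη.smooth k).mul (hθ.smooth k)
  abs_le_one k x := by
    rw [abs_mul]
    exact mul_le_one₀ (hη.abs_le_one k x) (abs_nonneg _) (hθ.abs_le_one k x)
  bound := by
    obtain ⟨C, hC⟩ := hη.bound
    obtain ⟨D, hD⟩ := hθ.bound
    refine ⟨D + C, fun k x hx i => ?_⟩
    have hd := fderiv_fun_mul ((hη.smooth k).differentiable (by simp) x)
      ((hθ.smooth k).differentiable (by simp) x)
    rw [hd]
    simp only [add_apply, smul_apply, smul_eq_mul]
    set a := fderiv ℝ (η k) x (EuclideanSpace.single i 1)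
    set b := fderiv ℝ (θ k) x (EuclideanSpace.single i 1)
    calc ‖f x‖ * |η k x * b + θ k x * a| ≤ ‖f x‖ * (1 * |b| + 1 * |a|) := by
          gcongr
          refine (abs_add_le _ _).trans ?_
          rw [abs_mul, abs_mul]
          gcongr
          exacts [hη.abs_le_one k x, hθ.abs_le_one k x]
      _ ≤ D + C := by linarith [hC k x hx i, hD k x hx i]
  eventually_one x hx := by
    filter_upwards [hη.eventually_one x hx, hθ.eventually_one x hx] with k h1 h2
    filter_upwards [h1, h2] with y h1 h2
    simp [h1, h2]

/-- The derivative is nonzero only for t in [1, 2]. With t equal to k times the distance to a side,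
this is the bound that controls f times the gradient of the cutoff: the chain rule produces a factor
k, and f supplies the distance. -/
theorem exists_abs_mul_deriv_smoothTransition_le :
    ∃ C : ℝ, ∀ t : ℝ, |t * deriv Real.smoothTransition (t - 1)| ≤ C := by
  have hc : Continuous fun t : ℝ => t * deriv Real.smoothTransition (t - 1) :=
    continuous_id.mul (((Real.smoothTransition.contDiff (n := 1)).continuous_deriv le_rfl).comp
      (continuous_id.sub continuous_const))
  obtain ⟨C, hC⟩ := (isCompact_Icc (a := (1 : ℝ)) (b := 2)).exists_bound_of_continuousOn
    hc.continuousOn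
  refine ⟨max C 0, fun t => ?_⟩
  rcases lt_or_ge t 1 with h | h
  · have : Real.smoothTransition =ᶠ[nhds (t - 1)] fun _ => 0 := by
      filter_upwards [gt_mem_nhds (show t - 1 < 0 by linarith)] with y hy
      exact Real.smoothTransition.zero_of_nonpos hy.le
    rw [this.deriv_eq]
    simp
  rcases lt_or_ge 2 t with h' | h'
  · have : Real.smoothTransition =ᶠ[nhds (t - 1)] fun _ => 1 := by
      filter_upwards [lt_mem_nhds (show 1 < t - 1 by linarith)] with y hy
      exact Real.smoothTransition.one_of_one_le hy.le
    rw [this.deriv_eq]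
    simp
  · exact (hC t ⟨h, h'⟩).trans (le_max_left _ _)

/-- The cutoff near a line to which `f` is adapted. -/
theorem isCutoff_smoothTransition {Ω : Set Plane} {f : Plane → ℂ} (a : Plane →L[ℝ] ℝ) (b : ℝ)
    (hpos : ∀ x ∈ Ω, 0 < a x + b) {C : ℝ} (hf : ∀ x ∈ Ω, ‖f x‖ ≤ C * (a x + b)) :
    IsCutoff Ω f fun k x => Real.smoothTransition (k * (a x + b) - 1) where
  smooth k := Real.smoothTransition.contDiff.comp (by fun_prop)
  abs_le_one k x := by
    rw [abs_of_nonneg (Real.smoothTransition.nonneg _)]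
    exact Real.smoothTransition.le_one _
  bound := by
    obtain ⟨D, hD⟩ := exists_abs_mul_deriv_smoothTransition_le
    refine ⟨|C| * (D * ‖a‖), fun k x hx i => ?_⟩
    have h1 : HasFDerivAt (fun x => (k : ℝ) * (a x + b) - 1) ((k : ℝ) • (a : Plane →L[ℝ] ℝ)) x :=
      ((a.hasFDerivAt.add_const b).const_mul (k : ℝ)).sub_const 1
    have h2 := ((Real.smoothTransition.contDiff (n := 1)).differentiable (by simp)
      ((k : ℝ) * (a x + b) - 1)).hasDerivAt.comp_hasFDerivAt x h1
    have h3 := h2.fderiv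
    simp only [Function.comp_def] at h3
    rw [h3]
    simp only [smul_apply, smul_eq_mul]
    have ha : |a (EuclideanSpace.single i 1)| ≤ ‖a‖ := by
      simpa using a.le_opNorm (EuclideanSpace.single i 1)
    have hp := hpos x hx
    have hD' := hD (k * (a x + b))
    have hD0 : 0 ≤ D := (abs_nonneg _).trans hD'
    calc ‖f x‖ * |deriv Real.smoothTransition (k * (a x + b) - 1) *
            (k * a (EuclideanSpace.single i 1))|
        ≤ (|C| * (a x + b)) * |deriv Real.smoothTransition (k * (a x + b) - 1) *
            (k * a (EuclideanSpace.single i 1))| := by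
          gcongr
          exact (hf x hx).trans (by gcongr; exact le_abs_self C)
      _ = |C| * (|k * (a x + b) * deriv Real.smoothTransition (k * (a x + b) - 1)| *
            |a (EuclideanSpace.single i 1)|) := by
          rw [abs_mul, abs_mul, abs_mul, abs_mul, abs_of_pos hp]
          ring
      _ ≤ |C| * (D * ‖a‖) := by gcongr
  eventually_one x hx := by
    have hp := hpos x hx
    obtain ⟨N, hN⟩ := exists_nat_gt (2 / (a x + b))
    filter_upwards [Filter.eventually_ge_atTop N] with k hk
    have h2 : 2 < (k : ℝ) * (a x + b) := by
      rw [← div_lt_iff₀ hp]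
      exact hN.trans_le (by exact_mod_cast hk)
    have hc : Continuous fun x => (k : ℝ) * (a x + b) := by fun_prop
    filter_upwards [hc.continuousAt.eventually (lt_mem_nhds h2)] with y hy
    exact Real.smoothTransition.one_of_one_le (by linarith)

theorem partialDeriv_ofReal_mul {f : Plane → ℂ} {η : Plane → ℝ} (hf : ContDiff ℝ ∞ f)
    (hη : ContDiff ℝ ∞ η) (i : Fin 2) (x : Plane) :
    partialDeriv i (fun x => (η x : ℂ) * f x) x =
      η x * partialDeriv i f x + f x * (fderiv ℝ η x (EuclideanSpace.single i 1) : ℝ) := by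
  have h1 : HasFDerivAt (fun x => (η x : ℂ)) (Complex.ofRealCLM ∘L fderiv ℝ η x) x :=
    Complex.ofRealCLM.hasFDerivAt.comp x (hη.differentiable (by simp) x).hasFDerivAt
  have h2 := (h1.mul (hf.differentiable (by simp) x).hasFDerivAt).fderiv
  rw [partialDeriv, show (fun x => (η x : ℂ) * f x) = (fun x => (η x : ℂ)) * f from rfl, h2]
  simp [partialDeriv]

/-- The approximants are η_k f. In the gradient η_k ∇f + f ∇η_k the factor ∇η_k may blow up, but f
∇η_k stays bounded and vanishes eventually at every point of Ω, so bounded convergence on the finite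
measure gives the limit in L². -/
theorem memH10_of_isCutoff {Ω : Set Plane} (hΩ : MeasurableSet Ω) (hfin : volume Ω ≠ ⊤)
    {f : Plane → ℂ} (hf : ContDiff ℝ ∞ f) (h0 : MemLp f 2 (volume.restrict Ω))
    (h1 : ∀ i, MemLp (partialDeriv i f) 2 (volume.restrict Ω)) {M : ℝ}
    (hM : ∀ x ∈ Ω, ‖f x‖ ≤ M) (hM' : ∀ i, ∀ x ∈ Ω, ‖partialDeriv i f x‖ ≤ M)
    {η : ℕ → Plane → ℝ} (hη : IsCutoff Ω f η)
    (htest : ∀ k, IsTestFunction Ω fun x => (η k x : ℂ) * f x) : MemH10 Ω (h0.toLp f) := by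
  have : IsFiniteMeasure (volume.restrict Ω) := ⟨by simpa using hfin.lt_top⟩
  refine ⟨fun i => (h1 i).toLp _, fun i => hasWeakPartial_toLp hf i h0 (h1 i), fun ε hε => ?_⟩
  have hle : ∀ k x, ‖(1 : ℂ) - η k x‖ ≤ 2 := fun k x => by
    refine (norm_sub_le _ _).trans ?_
    have := hη.abs_le_one k x
    rw [norm_one, Complex.norm_real, Real.norm_eq_abs]
    linarith
  have t0 : Filter.Tendsto (fun k => eLpNorm (fun x => f x - η k x * f x) 2 (volume.restrict Ω))
      Filter.atTop (nhds 0) := by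
    refine tendsto_eLpNorm_zero_of_bounded (C := 2 * M)
      (fun k => (h0.sub (htest k).memLp).1) (fun k => ?_) ?_
    · refine ae_restrict_of_forall_mem hΩ fun x hx => ?_
      rw [← one_sub_mul, norm_mul]
      exact mul_le_mul (hle k x) (hM x hx) (norm_nonneg _) (by norm_num)
    · refine ae_restrict_of_forall_mem hΩ fun x hx => ?_
      filter_upwards [hη.eventually_one x hx] with k hk
      simp [hk.eq_of_nhds]
  have t1 : ∀ i, Filter.Tendsto (fun k => eLpNorm (fun x => partialDeriv i f x -
      partialDeriv i (fun x => η k x * f x) x) 2 (volume.restrict Ω)) Filter.atTop (nhds 0) := by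
    intro i
    obtain ⟨C, hC⟩ := hη.bound
    refine tendsto_eLpNorm_zero_of_bounded (C := 2 * M + C)
      (fun k => ((h1 i).sub ((htest k).memLp_partialDeriv i)).1) (fun k => ?_) ?_
    · refine ae_restrict_of_forall_mem hΩ fun x hx => ?_
      rw [partialDeriv_ofReal_mul hf (hη.smooth k), ← sub_sub, ← one_sub_mul]
      refine (norm_sub_le _ _).trans (add_le_add ?_ ?_)
      · rw [norm_mul]
        exact mul_le_mul (hle k x) (hM' i x hx) (norm_nonneg _) (by norm_num)
      · rw [norm_mul, Complex.norm_real]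
        exact hC k x hx i
    · refine ae_restrict_of_forall_mem hΩ fun x hx => ?_
      filter_upwards [hη.eventually_one x hx] with k hk
      rw [partialDeriv_ofReal_mul hf (hη.smooth k), hk.fderiv_eq, hk.eq_of_nhds]
      simp
  have hev := ((t0.eventually (gt_mem_nhds hε)).and
    (Filter.eventually_all.2 fun i => (t1 i).eventually (gt_mem_nhds hε))).exists
  obtain ⟨k, hk0, hk1⟩ := hev
  refine ⟨_, htest k, lt_of_eq_of_lt (eLpNorm_congr_ae ?_) hk0,
    fun i => lt_of_eq_of_lt (eLpNorm_congr_ae ?_) (hk1 i)⟩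
  · filter_upwards [h0.coeFn_toLp] with x hx
    rw [hx]
  · filter_upwards [(h1 i).coeFn_toLp] with x hx
    rw [hx]

/-! ### The triangle -/

theorem isOpen_triangle (ℓ : ℝ) : IsOpen (triangle ℓ) := by
  have h : ∀ i, Continuous fun p : Plane => p i := fun i => by fun_prop
  exact (isOpen_lt continuous_const (h 1)).inter
    ((isOpen_lt (h 1) (continuous_const.mul (h 0))).inter
      (isOpen_lt (h 1) (continuous_const.mul (continuous_const.sub (h 0)))))

/-- The linear forms `α = 2 y / (√3 ℓ)` and `β = (√3 x - y) / (√3 ℓ)`, for which the triangle is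
`0 < α`, `0 < β`, `α + β < 1`. -/
def simpleRoot (ℓ : ℝ) : Fin 2 → Plane →L[ℝ] ℝ :=
  ![(2 / (√3 * ℓ)) • EuclideanSpace.proj 1,
    (1 / ℓ) • EuclideanSpace.proj 0 - (1 / (√3 * ℓ)) • EuclideanSpace.proj 1]

theorem simpleRoot_zero (ℓ : ℝ) (x : Plane) : simpleRoot ℓ 0 x = 2 / (√3 * ℓ) * x 1 := rfl

theorem simpleRoot_one (ℓ : ℝ) (x : Plane) :
    simpleRoot ℓ 1 x = 1 / ℓ * x 0 - 1 / (√3 * ℓ) * x 1 := rfl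

theorem mem_triangle_iff {ℓ : ℝ} (hℓ : 0 < ℓ) (x : Plane) :
    x ∈ triangle ℓ ↔ 0 < simpleRoot ℓ 0 x ∧ 0 < simpleRoot ℓ 1 x ∧
      simpleRoot ℓ 0 x + simpleRoot ℓ 1 x < 1 := by
  have h3 : 0 < √3 := by positivity
  have e0 : simpleRoot ℓ 0 x = 2 * x 1 / (√3 * ℓ) := by rw [simpleRoot_zero]; ring
  have e1 : simpleRoot ℓ 1 x = (√3 * x 0 - x 1) / (√3 * ℓ) := by
    rw [simpleRoot_one]; field_simp
  have e2 : simpleRoot ℓ 0 x + simpleRoot ℓ 1 x = (√3 * x 0 + x 1) / (√3 * ℓ) := by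
    rw [e0, e1]; ring
  rw [e2, e0, e1, div_lt_one (by positivity)]
  have hd : 0 < √3 * ℓ := by positivity
  simp only [triangle, Set.mem_ofPred_eq, div_pos_iff_of_pos_right hd]
  constructor
  · rintro ⟨h1, h2, h3⟩
    exact ⟨by linarith, by linarith, by linarith⟩
  · rintro ⟨h1, h2, h3⟩
    exact ⟨by linarith, by linarith, by linarith⟩

theorem isBounded_triangle {ℓ : ℝ} (hℓ : 0 < ℓ) : Bornology.IsBounded (triangle ℓ) := by
  refine (Metric.isBounded_closedBall (x := (0 : Plane)) (r := 2 * ℓ)).subset fun x hx => ?_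
  obtain ⟨h1, h2, h3⟩ := hx
  have hs : 0 < √3 := by positivity
  have hsq : √3 ^ 2 = 3 := Real.sq_sqrt (by norm_num)
  have h0 : 0 < x 0 := pos_of_mul_pos_right (h1.trans h2) hs.le
  have h0' : 0 < ℓ - x 0 := pos_of_mul_pos_right (h1.trans h3) hs.le
  rw [mem_closedBall_zero_iff, EuclideanSpace.norm_eq]
  refine Real.sqrt_le_iff.2 ⟨by positivity, ?_⟩
  have h4 : x 1 ^ 2 ≤ (√3 * ℓ) ^ 2 := by
    refine pow_le_pow_left₀ h1.le (h3.le.trans ?_) 2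
    gcongr
    linarith
  have h5 : x 0 ^ 2 ≤ ℓ ^ 2 := pow_le_pow_left₀ h0.le (by linarith) 2
  rw [Fin.sum_univ_two, Real.norm_eq_abs, Real.norm_eq_abs, sq_abs, sq_abs]
  nlinarith

theorem exists_norm_le_on_triangle {ℓ : ℝ} (hℓ : 0 < ℓ) {f : Plane → ℂ} (hf : Continuous f) :
    ∃ C, ∀ x ∈ triangle ℓ, ‖f x‖ ≤ C := by
  obtain ⟨C, hC⟩ := (isBounded_triangle hℓ).isCompact_closure.exists_bound_of_continuousOn
    hf.continuousOn
  exact ⟨C, fun x hx => hC x (subset_closure hx)⟩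

theorem volume_triangle_ne_top {ℓ : ℝ} (hℓ : 0 < ℓ) : volume (triangle ℓ) ≠ ⊤ :=
  (isBounded_triangle hℓ).measure_lt_top.ne

theorem isFiniteMeasure_restrict_triangle {ℓ : ℝ} (hℓ : 0 < ℓ) :
    IsFiniteMeasure (volume.restrict (triangle ℓ)) :=
  ⟨by simpa using (volume_triangle_ne_top hℓ).lt_top⟩

theorem memLp_triangle {ℓ : ℝ} (hℓ : 0 < ℓ) {f : Plane → ℂ} (hf : Continuous f) :
    MemLp f 2 (volume.restrict (triangle ℓ)) := by
  obtain ⟨C, hC⟩ := exists_norm_le_on_triangle hℓ hf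
  have := isFiniteMeasure_restrict_triangle hℓ
  exact MemLp.of_bound hf.aestronglyMeasurable C
    (ae_restrict_of_forall_mem (isOpen_triangle ℓ).measurableSet hC)

/-- A smooth function bounded by multiples of the distances to the sides belongs to `H¹₀`. -/
theorem memH10_triangle {ℓ : ℝ} (hℓ : 0 < ℓ) {f : Plane → ℂ} (hf : ContDiff ℝ ∞ f) {C : ℝ}
    (h0 : ∀ i, ∀ x ∈ triangle ℓ, ‖f x‖ ≤ C * simpleRoot ℓ i x)
    (h1 : ∀ x ∈ triangle ℓ, ‖f x‖ ≤ C * (1 - (simpleRoot ℓ 0 x + simpleRoot ℓ 1 x))) :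
    MemH10 (triangle ℓ) ((memLp_triangle hℓ hf.continuous).toLp f) := by
  obtain ⟨M, hM⟩ := exists_norm_le_on_triangle hℓ hf.continuous
  choose M' hM' using fun i => exists_norm_le_on_triangle hℓ (contDiff_partialDeriv hf i).continuous
  have c0 := isCutoff_smoothTransition (Ω := triangle ℓ) (f := f) (C := C) (simpleRoot ℓ 0) 0
    (fun x hx => by simpa using ((mem_triangle_iff hℓ x).1 hx).1)
    (fun x hx => by simpa using h0 0 x hx)
  have c1 := isCutoff_smoothTransition (Ω := triangle ℓ) (f := f) (C := C) (simpleRoot ℓ 1) 0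
    (fun x hx => by simpa using ((mem_triangle_iff hℓ x).1 hx).2.1)
    (fun x hx => by simpa using h0 1 x hx)
  have c2 := isCutoff_smoothTransition (Ω := triangle ℓ) (f := f) (C := C)
    (-(simpleRoot ℓ 0 + simpleRoot ℓ 1)) 1
    (fun x hx => by
      have := ((mem_triangle_iff hℓ x).1 hx).2.2
      simp only [neg_apply, add_apply]
      linarith)
    (fun x hx => by
      refine (h1 x hx).trans_eq ?_
      simp only [neg_apply, add_apply]
      ring)
  have c := (c0.mul c1).mul c2
  refine memH10_of_isCutoff (M := max M (max (M' 0) (M' 1))) (isOpen_triangle ℓ).measurableSet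
    (volume_triangle_ne_top hℓ) hf _
    (fun i => memLp_triangle hℓ (contDiff_partialDeriv hf i).continuous)
    (fun x hx => (hM x hx).trans (le_max_left _ _))
    (fun i x hx => (hM' i x hx).trans ?_) c fun k => ?_
  · fin_cases i <;> simp
  -- The points at which all three normalized distances are at least 1/k (none for k = 0). This
  -- closed bounded subset of the open triangle carries the support of the k-th approximant.
  · set K : Set Plane := {x | 1 ≤ k * (simpleRoot ℓ 0 x + 0)} ∩ ({x | 1 ≤ k * (simpleRoot ℓ 1 x + 0)} ∩
      {x | 1 ≤ k * ((-(simpleRoot ℓ 0 + simpleRoot ℓ 1)) x + 1)}) with hK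
    have hcl : IsClosed K := by
      refine IsClosed.inter (isClosed_le (by fun_prop) (by fun_prop))
        (IsClosed.inter (isClosed_le (by fun_prop) (by fun_prop))
          (isClosed_le (by fun_prop) (by fun_prop)))
    have hKT : K ⊆ triangle ℓ := by
      rintro x ⟨h1, h2, h3⟩
      have hpos : ∀ t : ℝ, 1 ≤ k * t → 0 < t := fun t ht =>
        pos_of_mul_pos_right (zero_lt_one.trans_le ht) (Nat.cast_nonneg k)
      have h1 := hpos _ h1
      have h2 := hpos _ h2
      have h3 := hpos _ h3
      simp only [neg_apply, add_apply] at h3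
      exact (mem_triangle_iff hℓ x).2 ⟨by linarith, by linarith, by linarith⟩
    have hsupp : Function.support (fun x => ((Real.smoothTransition (k * (simpleRoot ℓ 0 x + 0) - 1) *
        Real.smoothTransition (k * (simpleRoot ℓ 1 x + 0) - 1) *
        Real.smoothTransition (k * ((-(simpleRoot ℓ 0 + simpleRoot ℓ 1)) x + 1) - 1) : ℝ) : ℂ) * f x)
        ⊆ K := by
      intro x hx
      rw [Function.mem_support] at hx
      by_contra hxK
      have hz : ∀ t : ℝ, ¬ 1 ≤ t → Real.smoothTransition (t - 1) = 0 := fun t ht =>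
        Real.smoothTransition.zero_of_nonpos (by linarith [not_le.1 ht])
      simp only [hK, Set.mem_inter_iff, Set.mem_ofPred_eq, not_and_or] at hxK
      rcases hxK with h | h | h <;> rw [hz _ h] at hx <;> simp at hx
    exact ⟨(Complex.ofRealCLM.contDiff.comp (c.smooth k)).mul hf,
      HasCompactSupport.of_support_subset_isCompact
        (Metric.isCompact_of_isClosed_isBounded hcl ((isBounded_triangle hℓ).subset hKT)) hsupp,
      (closure_minimal hsupp hcl).trans hKT⟩

/-! ### Plane waves and their Weyl antisymmetrizations -/

/-- The linear form `m ω₁ + n ω₂`, where `ω₁ = (2α + β) / 3` and `ω₂ = (α + 2β) / 3`. -/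
def weight (ℓ : ℝ) (k : ℤ × ℤ) : Plane →L[ℝ] ℝ :=
  ((2 * k.1 + k.2 : ℝ) / 3) • simpleRoot ℓ 0 + ((k.1 + 2 * k.2 : ℝ) / 3) • simpleRoot ℓ 1

theorem weight_apply (ℓ : ℝ) (k : ℤ × ℤ) (x : Plane) : weight ℓ k x =
    (2 * k.1 + k.2 : ℝ) / 3 * simpleRoot ℓ 0 x + (k.1 + 2 * k.2 : ℝ) / 3 * simpleRoot ℓ 1 x := rfl

theorem weight_single_zero (ℓ : ℝ) (k : ℤ × ℤ) :
    weight ℓ k (EuclideanSpace.single 0 1) = (k.1 + 2 * k.2) / (3 * ℓ) := by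
  simp [weight_apply, simpleRoot_zero, simpleRoot_one]
  ring

theorem weight_single_one (ℓ : ℝ) (k : ℤ × ℤ) :
    weight ℓ k (EuclideanSpace.single 1 1) = k.1 / (√3 * ℓ) := by
  simp [weight_apply, simpleRoot_zero, simpleRoot_one]
  ring

/-- The plane wave `exp (2 π i (m ω₁ + n ω₂))`. -/
def wave (ℓ : ℝ) (k : ℤ × ℤ) (x : Plane) : ℂ :=
  Complex.exp (2 * Real.pi * Complex.I * weight ℓ k x)

theorem norm_exp_sub_exp_le (s t : ℝ) :
    ‖Complex.exp (2 * Real.pi * Complex.I * s) - Complex.exp (2 * Real.pi * Complex.I * t)‖ ≤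
      2 * Real.pi * |s - t| := by
  have h : Complex.exp (2 * Real.pi * Complex.I * s) - Complex.exp (2 * Real.pi * Complex.I * t) =
      Complex.exp (2 * Real.pi * Complex.I * t) *
        (Complex.exp (Complex.I * (2 * Real.pi * (s - t) : ℝ)) - 1) := by
    rw [mul_sub, ← Complex.exp_add, mul_one]
    congr 2
    push_cast
    ring
  have h1 : ‖Complex.exp (2 * Real.pi * Complex.I * t)‖ = 1 := by
    rw [show 2 * Real.pi * Complex.I * (t : ℂ) = ((2 * Real.pi * t : ℝ) : ℂ) * Complex.I by
      push_cast; ring]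
    exact Complex.norm_exp_ofReal_mul_I _
  rw [h, norm_mul, h1, one_mul]
  refine (Real.norm_exp_I_mul_ofReal_sub_one_le).trans_eq ?_
  rw [Real.norm_eq_abs, abs_mul, abs_of_pos (by positivity)]

/-- Two waves whose phases differ by `c * s` up to an integer. -/
theorem norm_wave_sub_wave_le {ℓ : ℝ} {k k' : ℤ × ℤ} {x : Plane} {c s : ℝ} (N : ℤ)
    (h : weight ℓ k x - weight ℓ k' x + N = c * s) :
    ‖wave ℓ k x - wave ℓ k' x‖ ≤ 2 * Real.pi * |c| * |s| := by
  have h1 : wave ℓ k x = Complex.exp (2 * Real.pi * Complex.I * (weight ℓ k x + N : ℝ)) := by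
    rw [wave, Complex.exp_eq_exp_iff_exists_int]
    exact ⟨-N, by push_cast; ring⟩
  rw [h1, wave]
  refine (norm_exp_sub_exp_le _ _).trans_eq ?_
  rw [mul_assoc (2 * Real.pi), ← abs_mul c s, ← h]
  congr 2
  ring

/-- A trigonometric sum. -/
def trigSum {ι : Type*} [Fintype ι] (ℓ : ℝ) (c : ι → ℂ) (k : ι → ℤ × ℤ) (x : Plane) : ℂ :=
  ∑ j, c j * wave ℓ (k j) x

theorem hasFDerivAt_wave (ℓ : ℝ) (k : ℤ × ℤ) (x : Plane) :
    HasFDerivAt (wave ℓ k)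
      (wave ℓ k x • ((2 * Real.pi * Complex.I) • (Complex.ofRealCLM ∘L weight ℓ k))) x := by
  have h := (Complex.ofRealCLM.hasFDerivAt.comp x (weight ℓ k).hasFDerivAt).const_mul
    (2 * Real.pi * Complex.I)
  exact h.cexp

theorem analyticOnNhd_wave (ℓ : ℝ) (k : ℤ × ℤ) : AnalyticOnNhd ℝ (wave ℓ k) Set.univ := fun x _ => by
  have h1 : AnalyticAt ℝ (fun x => 2 * Real.pi * Complex.I * (weight ℓ k x : ℂ)) x :=
    analyticAt_const.mul ((Complex.ofRealCLM ∘L weight ℓ k).analyticAt x)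
  exact (analyticAt_cexp.restrictScalars (𝕜 := ℝ)).comp h1

theorem analyticOnNhd_trigSum {ι : Type*} [Fintype ι] (ℓ : ℝ) (c : ι → ℂ) (k : ι → ℤ × ℤ) :
    AnalyticOnNhd ℝ (trigSum ℓ c k) Set.univ :=
  Finset.analyticOnNhd_fun_sum _ fun j _ => analyticOnNhd_const.mul (analyticOnNhd_wave ℓ (k j))

theorem contDiff_trigSum {ι : Type*} [Fintype ι] (ℓ : ℝ) (c : ι → ℂ) (k : ι → ℤ × ℤ) :
    ContDiff ℝ ∞ (trigSum ℓ c k) :=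
  contDiffOn_univ.1 ((analyticOnNhd_trigSum ℓ c k).contDiffOn uniqueDiffOn_univ)

theorem partialDeriv_trigSum {ι : Type*} [Fintype ι] (ℓ : ℝ) (c : ι → ℂ) (k : ι → ℤ × ℤ)
    (i : Fin 2) : partialDeriv i (trigSum ℓ c k) =
      trigSum ℓ (fun j => c j * (2 * Real.pi * Complex.I *
        weight ℓ (k j) (EuclideanSpace.single i 1))) k := by
  funext x
  have h : HasFDerivAt (trigSum ℓ c k) (∑ j, c j • (wave ℓ (k j) x •
      ((2 * Real.pi * Complex.I) • (Complex.ofRealCLM ∘L weight ℓ (k j))))) x :=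
    HasFDerivAt.fun_sum fun j _ => (hasFDerivAt_wave ℓ (k j) x).const_mul (c j)
  rw [partialDeriv, h.fderiv, trigSum]
  simp only [sum_apply, smul_apply, ContinuousLinearMap.comp_apply, Complex.ofRealCLM_apply,
    smul_eq_mul]
  exact Finset.sum_congr rfl fun j _ => by ring

/-- The Laplace eigenvalue `16 π² / (9 ℓ²) (m² + m n + n²)` of a plane wave. -/
def energy (ℓ : ℝ) (k : ℤ × ℤ) : ℝ :=
  16 * Real.pi ^ 2 / (9 * ℓ ^ 2) * ((k.1 : ℝ) ^ 2 + k.1 * k.2 + (k.2 : ℝ) ^ 2)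

theorem energy_eq {ℓ : ℝ} (hℓ : 0 < ℓ) (k : ℤ × ℤ) : energy ℓ k = (2 * Real.pi) ^ 2 *
    (weight ℓ k (EuclideanSpace.single 0 1) ^ 2 + weight ℓ k (EuclideanSpace.single 1 1) ^ 2) := by
  have hsq : √3 ^ 2 = 3 := Real.sq_sqrt (by norm_num)
  rw [weight_single_zero, weight_single_one, div_pow _ (√3 * ℓ), mul_pow √3, hsq, energy]
  field_simp
  ring

theorem laplacian_trigSum {ι : Type*} [Fintype ι] {ℓ : ℝ} (hℓ : 0 < ℓ) (c : ι → ℂ)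
    (k : ι → ℤ × ℤ) {lam : ℝ} (h : ∀ j, energy ℓ (k j) = lam) (x : Plane) :
    partialDeriv 0 (partialDeriv 0 (trigSum ℓ c k)) x +
      partialDeriv 1 (partialDeriv 1 (trigSum ℓ c k)) x + lam * trigSum ℓ c k x = 0 := by
  simp only [partialDeriv_trigSum]
  simp only [trigSum, Finset.mul_sum]
  rw [← Finset.sum_add_distrib, ← Finset.sum_add_distrib]
  refine Finset.sum_eq_zero fun j _ => ?_
  rw [← h j, energy_eq hℓ]
  push_cast
  ring_nf
  simp only [Complex.I_sq]
  ring

/-- The orbit of a weight under the Weyl group of type `A₂`. -/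
def weylOrbit (k : ℤ × ℤ) : Fin 6 → ℤ × ℤ :=
  ![(k.1, k.2), (-k.1, k.1 + k.2), (k.1 + k.2, -k.2), (-k.1 - k.2, k.1), (k.2, -k.1 - k.2),
    (-k.2, -k.1)]

/-- The signs of the elements of the Weyl group of type `A₂`. -/
def weylSign : Fin 6 → ℂ := ![1, -1, -1, 1, 1, -1]

/-- The Weyl antisymmetrization of a plane wave. -/
def altWave (ℓ : ℝ) (k : ℤ × ℤ) : Plane → ℂ := trigSum ℓ weylSign (weylOrbit k)

theorem altWave_apply (ℓ : ℝ) (k : ℤ × ℤ) (x : Plane) : altWave ℓ k x =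
    wave ℓ (k.1, k.2) x - wave ℓ (-k.1, k.1 + k.2) x - wave ℓ (k.1 + k.2, -k.2) x +
      wave ℓ (-k.1 - k.2, k.1) x + wave ℓ (k.2, -k.1 - k.2) x - wave ℓ (-k.2, -k.1) x := by
  simp [altWave, trigSum, Fin.sum_univ_six, weylSign, weylOrbit]
  ring

theorem energy_weylOrbit (ℓ : ℝ) (k : ℤ × ℤ) (j : Fin 6) :
    energy ℓ (weylOrbit k j) = energy ℓ k := by
  fin_cases j <;> simp [weylOrbit, energy] <;> ring_nf <;> simp

theorem norm_sum_three_le {a b c : ℂ} {p q r s : ℝ} (ha : ‖a‖ ≤ 2 * Real.pi * |p| * |s|)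
    (hb : ‖b‖ ≤ 2 * Real.pi * |q| * |s|) (hc : ‖c‖ ≤ 2 * Real.pi * |r| * |s|) (hs : 0 < s) :
    ‖a + b + c‖ ≤ 2 * Real.pi * (|p| + |q| + |r|) * s := by
  rw [abs_of_pos hs] at ha hb hc
  refine (norm_add₃_le).trans ?_
  linarith

/-- For each side, its reflection matches the six waves into three pairs of opposite sign. Within a
pair the phases differ by an integer multiple of the linear form of that side, the multipliers being
m, n and m + n up to sign. -/
theorem norm_altWave_le (ℓ : ℝ) (k : ℤ × ℤ) {x : Plane} :
    (0 < simpleRoot ℓ 0 x → ‖altWave ℓ k x‖ ≤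
      2 * Real.pi * (|(k.1 : ℝ)| + |(k.2 : ℝ)| + |(k.1 + k.2 : ℝ)|) * simpleRoot ℓ 0 x) ∧
    (0 < simpleRoot ℓ 1 x → ‖altWave ℓ k x‖ ≤
      2 * Real.pi * (|(k.1 : ℝ)| + |(k.2 : ℝ)| + |(k.1 + k.2 : ℝ)|) * simpleRoot ℓ 1 x) ∧
    (0 < 1 - (simpleRoot ℓ 0 x + simpleRoot ℓ 1 x) → ‖altWave ℓ k x‖ ≤
      2 * Real.pi * (|(k.1 : ℝ)| + |(k.2 : ℝ)| + |(k.1 + k.2 : ℝ)|) *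
        (1 - (simpleRoot ℓ 0 x + simpleRoot ℓ 1 x))) := by
  refine ⟨fun hs => ?_, fun hs => ?_, fun hs => ?_⟩
  · rw [show altWave ℓ k x = (wave ℓ (k.1, k.2) x - wave ℓ (-k.1, k.1 + k.2) x) +
        (wave ℓ (k.2, -k.1 - k.2) x - wave ℓ (-k.2, -k.1) x) +
        (wave ℓ (-k.1 - k.2, k.1) x - wave ℓ (k.1 + k.2, -k.2) x) by rw [altWave_apply]; ring]
    refine norm_sum_three_le (norm_wave_sub_wave_le 0 ?_) (norm_wave_sub_wave_le 0 ?_)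
      (abs_neg (k.1 + k.2 : ℝ) ▸ norm_wave_sub_wave_le 0 ?_) hs <;>
    · simp only [weight_apply]; push_cast; ring
  · rw [show altWave ℓ k x = (wave ℓ (-k.1 - k.2, k.1) x - wave ℓ (-k.2, -k.1) x) +
        (wave ℓ (k.1, k.2) x - wave ℓ (k.1 + k.2, -k.2) x) +
        (wave ℓ (k.2, -k.1 - k.2) x - wave ℓ (-k.1, k.1 + k.2) x) by rw [altWave_apply]; ring]
    refine norm_sum_three_le (norm_wave_sub_wave_le 0 ?_) (norm_wave_sub_wave_le 0 ?_)
      (abs_neg (k.1 + k.2 : ℝ) ▸ norm_wave_sub_wave_le 0 ?_) hs <;>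
    · simp only [weight_apply]; push_cast; ring
  · rw [show altWave ℓ k x = (wave ℓ (k.2, -k.1 - k.2) x - wave ℓ (k.1 + k.2, -k.2) x) +
        (wave ℓ (-k.1 - k.2, k.1) x - wave ℓ (-k.1, k.1 + k.2) x) +
        (wave ℓ (k.1, k.2) x - wave ℓ (-k.2, -k.1) x) by rw [altWave_apply]; ring]
    -- The third side is affine, so the phases match only after adding these integers, which do not
    -- change the waves.
    refine norm_sum_three_le (norm_wave_sub_wave_le k.1 ?_) (norm_wave_sub_wave_le k.2 ?_)
      (abs_neg (k.1 + k.2 : ℝ) ▸ norm_wave_sub_wave_le (-(k.1 + k.2)) ?_) hs <;>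
    · simp only [weight_apply]; push_cast; ring

theorem contDiff_altWave (ℓ : ℝ) (k : ℤ × ℤ) : ContDiff ℝ ∞ (altWave ℓ k) :=
  contDiff_trigSum _ _ _

/-- The class of `altWave` in `L²` of the triangle. -/
def altWaveL2 {ℓ : ℝ} (hℓ : 0 < ℓ) (k : ℤ × ℤ) : L2 (triangle ℓ) :=
  (memLp_triangle hℓ (contDiff_altWave ℓ k).continuous).toLp (altWave ℓ k)

theorem solvesDirichlet_altWaveL2 {ℓ : ℝ} (hℓ : 0 < ℓ) (k : ℤ × ℤ) :
    SolvesDirichlet (triangle ℓ) (energy ℓ k) (altWaveL2 hℓ k) := by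
  have hs := contDiff_altWave ℓ k
  have hs1 : ∀ i, ContDiff ℝ ∞ (partialDeriv i (altWave ℓ k)) := contDiff_partialDeriv hs
  have hs2 : ∀ i j, ContDiff ℝ ∞ (partialDeriv j (partialDeriv i (altWave ℓ k))) :=
    fun i => contDiff_partialDeriv (hs1 i)
  refine ⟨memH10_triangle hℓ hs (C := 2 * Real.pi * (|(k.1 : ℝ)| + |(k.2 : ℝ)| +
      |(k.1 + k.2 : ℝ)|)) (fun i x hx => ?_) (fun x hx => ?_),
    fun i => (memLp_triangle hℓ (hs1 i).continuous).toLp _,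
    fun i j => (memLp_triangle hℓ (hs2 i j).continuous).toLp _,
    ⟨fun i => hasWeakPartial_toLp hs i _ _, fun i j => hasWeakPartial_toLp (hs1 i) j _ _⟩, ?_⟩
  · have hx' := (mem_triangle_iff hℓ x).1 hx
    fin_cases i
    · exact (norm_altWave_le ℓ k).1 hx'.1
    · exact (norm_altWave_le ℓ k).2.1 hx'.2.1
  · exact (norm_altWave_le ℓ k).2.2 (by linarith [((mem_triangle_iff hℓ x).1 hx).2.2])
  · rw [altWaveL2, ← MemLp.toLp_const_smul, ← MemLp.toLp_add, ← MemLp.toLp_add]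
    rw [Lp.eq_zero_iff_ae_eq_zero]
    refine (MemLp.coeFn_toLp _).trans (Filter.Eventually.of_forall fun x => ?_)
    exact laplacian_trigSum hℓ weylSign (weylOrbit k) (energy_weylOrbit ℓ k) x

theorem solvesDirichlet_altWaveL2_of_eq {ℓ : ℝ} (hℓ : 0 < ℓ) {lam : ℝ} {k : ℤ × ℤ}
    (h : lam = energy ℓ k) : SolvesDirichlet (triangle ℓ) lam (altWaveL2 hℓ k) := by
  subst h
  exact solvesDirichlet_altWaveL2 hℓ k

/-! ### Linear independence of the eigenfunctions -/

theorem wave_add (ℓ : ℝ) (k : ℤ × ℤ) (x y : Plane) :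
    wave ℓ k (x + y) = wave ℓ k x * wave ℓ k y := by
  simp only [wave, map_add, Complex.ofReal_add, mul_add, Complex.exp_add]

/-- A plane wave as a character of the plane. -/
def waveHom (ℓ : ℝ) (k : ℤ × ℤ) : Multiplicative Plane →* ℂ where
  toFun x := wave ℓ k x.toAdd
  map_one' := by simp [wave]
  map_mul' x y := wave_add ℓ k _ _

/-- The derivative at the origin recovers the linear form `weight`, and its values on the standard
basis determine k. -/
theorem wave_injective {ℓ : ℝ} (hℓ : 0 < ℓ) : Function.Injective (wave ℓ) := by
  intro k k' h
  have hw : ∀ i, weight ℓ k (EuclideanSpace.single i 1) =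
      weight ℓ k' (EuclideanSpace.single i 1) := fun i => by
    have h1 := (hasFDerivAt_wave ℓ k 0).fderiv
    rw [h, (hasFDerivAt_wave ℓ k' 0).fderiv] at h1
    have h2 := congrArg (fun L : Plane →L[ℝ] ℂ => L (EuclideanSpace.single i 1)) h1
    have h3 : wave ℓ k' 0 ≠ 0 := Complex.exp_ne_zero _
    simp only [smul_apply, ContinuousLinearMap.comp_apply, Complex.ofRealCLM_apply,
      smul_eq_mul, mul_eq_mul_left_iff, h3, or_false, Complex.two_pi_I_ne_zero] at h2
    exact (Complex.ofReal_injective h2).symm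
  have h0 := hw 0
  have h1 := hw 1
  rw [weight_single_zero, weight_single_zero, div_left_inj' (by positivity)] at h0
  rw [weight_single_one, weight_single_one, div_left_inj' (by positivity)] at h1
  ext
  · exact_mod_cast h1
  · have : (k.2 : ℝ) = k'.2 := by linarith
    exact_mod_cast this

theorem linearIndependent_wave {ℓ : ℝ} (hℓ : 0 < ℓ) :
    LinearIndependent ℂ (wave ℓ : ℤ × ℤ → Plane → ℂ) := by
  have hinj : Function.Injective (waveHom ℓ) := fun k k' h =>
    wave_injective hℓ (congrArg (fun f : Multiplicative Plane →* ℂ => (f : Plane → ℂ)) h)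
  exact (linearIndependent_monoidHom (Multiplicative Plane) ℂ).comp (waveHom ℓ) hinj

/-- A pair of positive integers as a pair of integers. -/
def intPair (p : ℕ+ × ℕ+) : ℤ × ℤ := (p.1, p.2)

/-- The coefficients of `altWave` with respect to plane waves. -/
def altCoeff (k : ℤ × ℤ) : (ℤ × ℤ) →₀ ℂ :=
  ∑ j, Finsupp.single (weylOrbit k j) (weylSign j)

theorem linearCombination_altCoeff (ℓ : ℝ) (k : ℤ × ℤ) :
    Finsupp.linearCombination ℂ (wave ℓ) (altCoeff k) = altWave ℓ k := by
  funext x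
  simp [altCoeff, altWave, trigSum]

/-- Of the six weights in the orbit of a pair of positive integers only the pair itself has both
entries positive. Restricted to the open chamber the coefficient matrix is thus the identity, which
yields independence. -/
theorem altCoeff_intPair (p q : ℕ+ × ℕ+) :
    altCoeff (intPair p) (intPair q) = if p = q then 1 else 0 := by
  obtain ⟨m, n⟩ := p
  obtain ⟨m', n'⟩ := q
  have := m.pos
  have := n.pos
  have := m'.pos
  have := n'.pos
  have h3 : ¬ (-(m : ℤ) - n = m') := by omega
  have h4 : ¬ (-(m : ℤ) - n = n') := by omega
  simp [altCoeff, Fin.sum_univ_six, weylOrbit, weylSign, intPair, Finsupp.single_apply, h3, h4]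

theorem linearIndependent_altWave {ℓ : ℝ} (hℓ : 0 < ℓ) :
    LinearIndependent ℂ fun p : ℕ+ × ℕ+ => altWave ℓ (intPair p) := by
  have h1 : LinearIndependent ℂ fun p : ℕ+ × ℕ+ => altCoeff (intPair p) := by
    rw [linearIndependent_iff']
    intro s g hg i hi
    have := DFunLike.congr_fun hg (intPair i)
    simpa [Finsupp.finsetSum_apply, altCoeff_intPair, hi] using this
  have h2 := h1.map' (Finsupp.linearCombination ℂ (wave ℓ))
    (linearIndependent_iff_ker.1 (linearIndependent_wave hℓ))
  simpa only [Function.comp_def, linearCombination_altCoeff] using h2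

/-- Restriction of continuous functions to the triangle. -/
def restrictL2 {ℓ : ℝ} (hℓ : 0 < ℓ) : C(Plane, ℂ) →ₗ[ℂ] L2 (triangle ℓ) where
  toFun f := (memLp_triangle hℓ f.continuous).toLp f
  map_add' _ _ := rfl
  map_smul' _ _ := rfl

theorem triangle_nonempty {ℓ : ℝ} (hℓ : 0 < ℓ) : (triangle ℓ).Nonempty := by
  have hs : 0 < √3 := by positivity
  have h1 : √3 ^ 2 = 3 := Real.sq_sqrt (by norm_num)
  have h2 : 1 < √3 := by nlinarith
  have h3 : ℓ / 4 < √3 * (ℓ / 2) := by nlinarith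
  refine ⟨!₂[ℓ / 2, ℓ / 4], ?_⟩
  simp only [triangle, Set.mem_ofPred_eq, Matrix.cons_val_zero,
    Matrix.cons_val_one]
  refine ⟨by positivity, h3, ?_⟩
  rwa [show ℓ - ℓ / 2 = ℓ / 2 by ring]

/-- Analytic continuation from the triangle to the plane. -/
theorem eq_zero_of_restrictL2_eq_zero {ℓ : ℝ} (hℓ : 0 < ℓ) (f : C(Plane, ℂ))
    (hf : AnalyticOnNhd ℝ f Set.univ) (h : restrictL2 hℓ f = 0) : (f : Plane → ℂ) = 0 := by
  have h1 : (f : Plane → ℂ) =ᵐ[volume.restrict (triangle ℓ)] 0 :=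
    (memLp_triangle hℓ f.continuous).coeFn_toLp.symm.trans (Lp.eq_zero_iff_ae_eq_zero.1 h)
  have h2 : Set.EqOn f 0 (triangle ℓ) :=
    Measure.eqOn_open_of_ae_eq h1 (isOpen_triangle ℓ) f.continuous.continuousOn
      continuousOn_const
  obtain ⟨x, hx⟩ := triangle_nonempty hℓ
  have h3 := hf.eqOn_zero_of_preconnected_of_eventuallyEq_zero isPreconnected_univ
    (Set.mem_univ x) (h2.eventuallyEq_of_mem ((isOpen_triangle ℓ).mem_nhds hx))
  funext y
  exact h3 (Set.mem_univ y)

/-- A relation in L² of the triangle is an almost everywhere identity of analytic functions there,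
hence an identity on the whole plane, where independence is known. -/
theorem linearIndependent_altWaveL2 {ℓ : ℝ} (hℓ : 0 < ℓ) :
    LinearIndependent ℂ fun p : ℕ+ × ℕ+ => altWaveL2 hℓ (intPair p) := by
  rw [linearIndependent_iff']
  intro s g hg
  let w : ℕ+ × ℕ+ → C(Plane, ℂ) := fun p =>
    ⟨altWave ℓ (intPair p), (contDiff_altWave ℓ _).continuous⟩
  have h1 : restrictL2 hℓ (∑ p ∈ s, g p • w p) = 0 := by
    rw [map_sum, ← hg]
    exact Finset.sum_congr rfl fun p _ => map_smul _ _ _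
  have hc : ((∑ p ∈ s, g p • w p : C(Plane, ℂ)) : Plane → ℂ) =
      ∑ p ∈ s, g p • altWave ℓ (intPair p) := by
    funext x
    simp [w, Finset.sum_apply]
  have h2 := eq_zero_of_restrictL2_eq_zero hℓ _ ?_ h1
  · rw [hc] at h2
    exact linearIndependent_iff'.1 (linearIndependent_altWave hℓ) s g h2
  · rw [hc]
    exact Finset.analyticOnNhd_sum _ fun p _ =>
      (analyticOnNhd_trigSum ℓ weylSign (weylOrbit (intPair p))).const_smul

theorem mk_le_rank_dirichletEigenspace {ℓ : ℝ} (hℓ : 0 < ℓ) (lam : ℝ) :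
    Cardinal.mk {p : ℕ+ × ℕ+ // lam = energy ℓ (intPair p)} ≤
      Module.rank ℂ (dirichletEigenspace (triangle ℓ) lam) := by
  let v : {p : ℕ+ × ℕ+ // lam = energy ℓ (intPair p)} → dirichletEigenspace (triangle ℓ) lam :=
    fun p => ⟨altWaveL2 hℓ (intPair p.1), solvesDirichlet_altWaveL2_of_eq hℓ p.2⟩
  have hv : LinearIndependent ℂ v := by
    refine LinearIndependent.of_comp (dirichletEigenspace (triangle ℓ) lam).subtype ?_
    exact (linearIndependent_altWaveL2 hℓ).comp _ Subtype.val_injective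
  exact hv.cardinal_le_rank

/-! ### Completeness of the eigenfunctions -/

theorem altWave_weylOrbit (ℓ : ℝ) (k : ℤ × ℤ) (j : Fin 6) (x : Plane) :
    altWave ℓ (weylOrbit k j) x = weylSign j * altWave ℓ k x := by
  fin_cases j <;> simp [altWave_apply, weylOrbit, weylSign] <;> ring_nf

theorem altWave_zero_left (ℓ : ℝ) (n : ℤ) (x : Plane) : altWave ℓ (0, n) x = 0 := by
  simp [altWave_apply]

theorem altWave_zero_right (ℓ : ℝ) (m : ℤ) (x : Plane) : altWave ℓ (m, 0) x = 0 := by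
  simp [altWave_apply]

/-- Orthogonality to `altWave` need only be checked in the open Weyl chamber. -/
theorem integral_mul_altWave_eq_zero_of_dominant {ℓ : ℝ} (u : L2 (triangle ℓ))
    (h : ∀ m n : ℤ, 0 < m → 0 < n → ∫ x in triangle ℓ, u x * altWave ℓ (m, n) x = 0)
    (k : ℤ × ℤ) : ∫ x in triangle ℓ, u x * altWave ℓ k x = 0 := by
  have hsign : ∀ j, weylSign j ≠ 0 := fun j => by fin_cases j <;> simp [weylSign]
  have hW : ∀ j, 0 < (weylOrbit k j).1 → 0 < (weylOrbit k j).2 →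
      ∫ x in triangle ℓ, u x * altWave ℓ k x = 0 := fun j h1 h2 => by
    have h3 := h _ _ h1 h2
    simp only [Prod.mk.eta, altWave_weylOrbit, mul_left_comm _ (weylSign j)] at h3
    rw [integral_const_mul] at h3
    exact (mul_eq_zero.1 h3).resolve_left (hsign j)
  obtain ⟨m, n⟩ := k
  -- On the walls m = 0, n = 0, m + n = 0 the antisymmetrized wave vanishes; off them some Weyl
  -- image of (m, n) is dominant, and passing to it changes only the sign.
  rcases eq_or_ne m 0 with rfl | hm
  · simp [altWave_zero_left]
  rcases eq_or_ne n 0 with rfl | hn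
  · simp [altWave_zero_right]
  rcases eq_or_ne (m + n) 0 with h0 | hmn
  · have hz : ∀ x, altWave ℓ (m, n) x = 0 := fun x => by
      have h1 := altWave_weylOrbit ℓ (m, n) 1 x
      simpa [weylOrbit, weylSign, h0, altWave_zero_right] using h1
    simp [hz]
  have : ∃ j, 0 < (weylOrbit (m, n) j).1 ∧ 0 < (weylOrbit (m, n) j).2 := by
    simp only [Fin.exists_fin_succ, weylOrbit]
    simp
    omega
  obtain ⟨j, h1, h2⟩ := this
  exact hW j h1 h2

/-- The point of the torus with coordinates `(ω₁, ω₂)` transformed by an element of the Weyl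
group. -/
def weylCoord (ℓ : ℝ) (j : Fin 6) (x : Plane) : Fin 2 → ℝ :=
  ![weight ℓ (weylOrbit (1, 0) j) x, weight ℓ (weylOrbit (0, 1) j) x]

/-- The image of `weylCoord` in the torus. -/
def torusPoint (ℓ : ℝ) (j : Fin 6) (x : Plane) : UnitAddTorus (Fin 2) :=
  fun i => (weylCoord ℓ j x i : UnitAddCircle)

theorem torusPoint_eq (ℓ : ℝ) (j : Fin 6) (x : Plane) :
    torusPoint ℓ j x = fun i => (weylCoord ℓ j x i : UnitAddCircle) := rfl

theorem continuous_torusPoint (ℓ : ℝ) (j : Fin 6) : Continuous (torusPoint ℓ j) := by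
  refine continuous_pi fun i => (AddCircle.continuous_mk' _).comp ?_
  fin_cases i
  · exact (weight ℓ (weylOrbit (1, 0) j)).continuous
  · exact (weight ℓ (weylOrbit (0, 1) j)).continuous

theorem mFourier_torusPoint (ℓ : ℝ) (n : Fin 2 → ℤ) (j : Fin 6) (x : Plane) :
    UnitAddTorus.mFourier n (torusPoint ℓ j x) = wave ℓ (weylOrbit (n 0, n 1) j) x := by
  have h : (weight ℓ (weylOrbit (n 0, n 1) j) x) = n 0 * weight ℓ (weylOrbit (1, 0) j) x +
      n 1 * weight ℓ (weylOrbit (0, 1) j) x := by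
    fin_cases j <;> simp [weylOrbit, weight_apply] <;> ring
  simp only [UnitAddTorus.mFourier, ContinuousMap.coe_mk, Fin.prod_univ_two, torusPoint,
    fourier_coe_apply, weylCoord, Matrix.cons_val_zero, Matrix.cons_val_one]
  rw [← Complex.exp_add, wave, h]
  congr 1
  push_cast
  ring

/-- The functional `F ↦ ∫ u F(w x)` on continuous functions on the torus. -/
def torusFunctional {ℓ : ℝ} (hℓ : 0 < ℓ) (u : L2 (triangle ℓ)) (j : Fin 6) :
    C(UnitAddTorus (Fin 2), ℂ) →L[ℂ] ℂ :=
  have hi (F : C(UnitAddTorus (Fin 2), ℂ)) : Integrable (fun x => u x * F (torusPoint ℓ j x))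
      (volume.restrict (triangle ℓ)) :=
    L2.integrable_mul u (memLp_triangle hℓ (F.continuous.comp (continuous_torusPoint ℓ j)))
  LinearMap.mkContinuous
    { toFun := fun F => ∫ x in triangle ℓ, u x * F (torusPoint ℓ j x)
      map_add' := fun F G => by
        rw [← integral_add (hi F) (hi G)]
        simp [mul_add]
      map_smul' := fun c F => by
        rw [RingHom.id_apply, smul_eq_mul, ← integral_const_mul]
        simp [mul_left_comm] }
    (∫ x in triangle ℓ, ‖u x‖) fun F => by
      have := isFiniteMeasure_restrict_triangle hℓ
      rw [← integral_mul_const]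
      refine norm_integral_le_of_norm_le
        (((Lp.memLp u).integrable (by norm_num)).norm.mul_const _) ?_
      exact Filter.Eventually.of_forall fun x => by
        rw [norm_mul]
        gcongr
        exact F.norm_coe_le_norm _

theorem torusFunctional_apply {ℓ : ℝ} (hℓ : 0 < ℓ) (u : L2 (triangle ℓ)) (j : Fin 6)
    (F : C(UnitAddTorus (Fin 2), ℂ)) :
    torusFunctional hℓ u j F = ∫ x in triangle ℓ, u x * F (torusPoint ℓ j x) := rfl

/-- On a Fourier monomial the alternating sum is the pairing of u with an `altWave`. The monomials
span a dense subspace and the functional is continuous for the sup norm. -/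
theorem sum_torusFunctional_eq_zero {ℓ : ℝ} (hℓ : 0 < ℓ) (u : L2 (triangle ℓ))
    (h : ∀ k, ∫ x in triangle ℓ, u x * altWave ℓ k x = 0) :
    ∑ j, weylSign j • torusFunctional hℓ u j = 0 := by
  refine ContinuousLinearMap.ext_on (s := Set.range UnitAddTorus.mFourier)
    (Submodule.dense_iff_topologicalClosure_eq_top.2 UnitAddTorus.span_mFourier_closure_eq_top) ?_
  rintro _ ⟨n, rfl⟩
  have hn := h (n 0, n 1)
  simp only [altWave, trigSum, Finset.mul_sum] at hn
  rw [integral_finsetSum] at hn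
  · simp only [sum_apply, smul_apply, smul_eq_mul, zero_apply, torusFunctional_apply,
      mFourier_torusPoint]
    rw [← hn]
    refine Finset.sum_congr rfl fun j _ => ?_
    rw [← integral_const_mul]
    simp only [mul_left_comm]
  · intro j _
    simp only [mul_left_comm _ (weylSign j)]
    exact (L2.integrable_mul u (memLp_triangle hℓ
      (contDiff_trigSum ℓ (fun _ : Fin 1 => 1) (fun _ => weylOrbit (n 0, n 1) j)).continuous)
      |>.congr (Filter.Eventually.of_forall fun x => by simp [trigSum])).const_mul _

/-- The point of the plane with `ω₁ = p` and `ω₂ = r`. -/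
def planePoint (ℓ p r : ℝ) : Plane := !₂[3 * ℓ / 2 * r, √3 * ℓ * (p - r / 2)]

theorem continuous_planePoint (ℓ : ℝ) : Continuous fun z : ℝ × ℝ => planePoint ℓ z.1 z.2 := by
  refine (PiLp.continuous_toLp 2 _).comp (continuous_pi fun i => ?_)
  fin_cases i
  · simp only [Fin.zero_eta, Matrix.cons_val_zero]
    fun_prop
  · simp only [Fin.mk_one, Matrix.cons_val_one, Matrix.cons_val_fin_one]
    fun_prop

theorem simpleRoot_planePoint {ℓ : ℝ} (hℓ : 0 < ℓ) (p r : ℝ) :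
    simpleRoot ℓ 0 (planePoint ℓ p r) = 2 * p - r ∧
      simpleRoot ℓ 1 (planePoint ℓ p r) = 2 * r - p := by
  have hs : √3 ≠ 0 := by positivity
  rw [simpleRoot_zero, simpleRoot_one]
  simp only [planePoint, Matrix.cons_val_zero, Matrix.cons_val_one, Matrix.cons_val_fin_one]
  constructor
  · field_simp
  · field_simp
    ring

theorem planePoint_weight {ℓ : ℝ} (hℓ : 0 < ℓ) (x : Plane) :
    planePoint ℓ (weight ℓ (1, 0) x) (weight ℓ (0, 1) x) = x := by
  have hs : √3 ≠ 0 := by positivity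
  ext i
  fin_cases i
  · simp [planePoint, weight_apply, simpleRoot_zero, simpleRoot_one]
    field_simp
    ring
  · simp [planePoint, weight_apply, simpleRoot_zero, simpleRoot_one]
    field_simp
    ring

theorem mem_Ioo_of_planePoint_mem_triangle {ℓ : ℝ} (hℓ : 0 < ℓ) {p r : ℝ}
    (h : planePoint ℓ p r ∈ triangle ℓ) : p ∈ Set.Ioo 0 1 ∧ r ∈ Set.Ioo 0 1 := by
  rw [mem_triangle_iff hℓ, (simpleRoot_planePoint hℓ p r).1, (simpleRoot_planePoint hℓ p r).2] at h
  obtain ⟨h1, h2, h3⟩ := h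
  exact ⟨⟨by linarith, by linarith⟩, by linarith, by linarith⟩

/-- The periodization of a continuous function supported in the triangle. -/
theorem exists_periodization {ℓ : ℝ} (hℓ : 0 < ℓ) {φ : Plane → ℂ} (hc : Continuous φ)
    (hφ : ∀ x, x ∉ triangle ℓ → φ x = 0) :
    ∃ F : C(UnitAddTorus (Fin 2), ℂ), ∀ z : Fin 2 → ℝ,
      F (fun i => (z i : UnitAddCircle)) = φ (planePoint ℓ (Int.fract (z 0)) (Int.fract (z 1))) := by
  let e : UnitAddCircle → ℝ := fun θ => AddCircle.equivIco 1 0 θ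
  have he : ∀ t : ℝ, e (t : UnitAddCircle) = Int.fract t := fun t => by
    simp [e, AddCircle.coe_equivIco_mk_apply]
  have hz : ∀ p r : ℝ, ¬ (p ∈ Set.Ioo (0 : ℝ) 1 ∧ r ∈ Set.Ioo (0 : ℝ) 1) →
      φ (planePoint ℓ p r) = 0 := fun p r h =>
    hφ _ fun hx => h (mem_Ioo_of_planePoint_mem_triangle hℓ hx)
  have hcp : ∀ {X : Type} [TopologicalSpace X] {a b : X → ℝ}, Continuous a → Continuous b →
      Continuous fun x => φ (planePoint ℓ (a x) (b x)) := fun ha hb =>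
    hc.comp ((continuous_planePoint ℓ).comp (ha.prodMk hb))
  -- The fractional part jumps at integers, so continuity needs only that the values at 0 and 1
  -- agree. Both are zero, since the triangle lies in the open unit square of the coordinates (ω₁,
  -- ω₂). The two variables are treated one after the other.
  have h1 : Continuous fun z : ℝ × ℝ => φ (planePoint ℓ z.1 (Int.fract z.2)) :=
    ContinuousOn.comp_fract (f := fun (z : ℝ × ℝ) t => φ (planePoint ℓ z.1 t))
      (hcp (continuous_fst.comp continuous_fst) continuous_snd).continuousOn continuous_snd
      fun z => by rw [hz _ _ (by simp), hz _ _ (by simp)]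
  have h2 : Continuous fun z : Fin 2 → ℝ =>
      φ (planePoint ℓ (Int.fract (z 0)) (Int.fract (z 1))) :=
    ContinuousOn.comp_fract (f := fun (z : Fin 2 → ℝ) t => φ (planePoint ℓ t (Int.fract (z 1))))
      (h1.comp (continuous_snd.prodMk ((continuous_apply 1).comp continuous_fst))).continuousOn
      (continuous_apply 0) fun z => by rw [hz _ _ (by simp), hz _ _ (by simp)]
  have hq : IsOpenQuotientMap (Pi.map fun (_ : Fin 2) (t : ℝ) => (t : UnitAddCircle)) :=
    IsOpenQuotientMap.piMap fun _ => QuotientAddGroup.isOpenQuotientMap_mk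
  refine ⟨⟨fun θ => φ (planePoint ℓ (e (θ 0)) (e (θ 1))), ?_⟩, fun z => ?_⟩
  · rw [hq.isQuotientMap.continuous_iff]
    simpa only [Function.comp_def, Pi.map_apply, he] using h2
  · simp only [ContinuousMap.coe_mk, he]

/-- The triangle is disjoint from its images under the non-trivial elements of the Weyl group,
up to the lattice. -/
theorem eq_zero_of_weylCoord_eq {ℓ : ℝ} (hℓ : 0 < ℓ) {j : Fin 6} {x y : Plane}
    (hx : x ∈ triangle ℓ) (hy : y ∈ triangle ℓ) {a b : ℤ}
    (ha : weight ℓ (1, 0) y = weylCoord ℓ j x 0 - a)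
    (hb : weight ℓ (0, 1) y = weylCoord ℓ j x 1 - b) : j = 0 := by
  obtain ⟨x1, x2, x3⟩ := (mem_triangle_iff hℓ x).1 hx
  obtain ⟨y1, y2, y3⟩ := (mem_triangle_iff hℓ y).1 hy
  have pos : ∀ (N : ℤ) (u v : ℝ), 0 < u → u < 1 → 0 < v → v < 1 → u - v = N → N = 0 := by
    intro N u v hu hu' hv hv' h
    have h1 : N < 1 := by exact_mod_cast (by linarith : (N : ℝ) < 1)
    have h2 : -1 < N := by exact_mod_cast (by linarith : (-1 : ℝ) < N)
    omega
  have neg : ∀ (N : ℤ) (u v : ℝ), 0 < u → u < 1 → 0 < v → v < 1 → -u - v = N → N = -1 := by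
    intro N u v hu hu' hv hv' h
    have h1 : N < 0 := by exact_mod_cast (by linarith : (N : ℝ) < 0)
    have h2 : -2 < N := by exact_mod_cast (by linarith : (-2 : ℝ) < N)
    omega
  set s := simpleRoot ℓ 0 x
  set t := simpleRoot ℓ 1 x
  set s' := simpleRoot ℓ 0 y
  set t' := simpleRoot ℓ 1 y
  rw [weight_apply] at ha hb
  by_contra hj
  fin_cases j <;> simp [weylCoord, weylOrbit, weight_apply] at ha hb hj
  -- Applying the simple roots to y determines the integers 2a - b and 2b - a. In this and the next
  -- three cases one is 0 and the other -1, which is impossible modulo 3.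
  · have := neg (2 * a - b) s s' x1 (by linarith) y1 (by linarith) (by push_cast; linarith)
    have := pos (2 * b - a) (s + t) t' (by linarith) x3 y2 (by linarith) (by push_cast; linarith)
    omega
  · have := pos (2 * a - b) (s + t) s' (by linarith) x3 y1 (by linarith) (by push_cast; linarith)
    have := neg (2 * b - a) t t' x2 (by linarith) y2 (by linarith) (by push_cast; linarith)
    omega
  · have := pos (2 * a - b) t s' x2 (by linarith) y1 (by linarith) (by push_cast; linarith)
    have := neg (2 * b - a) (s + t) t' (by linarith) x3 y2 (by linarith) (by push_cast; linarith)
    omega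
  · have := neg (2 * a - b) (s + t) s' (by linarith) x3 y1 (by linarith) (by push_cast; linarith)
    have := pos (2 * b - a) s t' x1 (by linarith) y2 (by linarith) (by push_cast; linarith)
    omega
  -- For the longest element both are -1, which allows a = b = -1, the reflection in the third side.
  -- This is excluded by α + β < 1 at x and y, which forces a + b = -1.
  · have := neg (2 * a - b) t s' x2 (by linarith) y1 (by linarith) (by push_cast; linarith)
    have := neg (2 * b - a) s t' x1 (by linarith) y2 (by linarith) (by push_cast; linarith)
    have := neg (a + b) (s + t) (s' + t') (by linarith) x3 (by linarith) y3
      (by push_cast; linarith)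
    omega

/-- Completeness of the antisymmetrized plane waves in `L²` of the triangle. -/
theorem eq_zero_of_integral_mul_altWave {ℓ : ℝ} (hℓ : 0 < ℓ) (u : L2 (triangle ℓ))
    (h : ∀ k, ∫ x in triangle ℓ, u x * altWave ℓ k x = 0) : u = 0 := by
  refine L2.eq_zero_of_forall_testFunction (isOpen_triangle ℓ) u fun φ hφ => ?_
  have hφ0 : ∀ x, x ∉ triangle ℓ → φ x = 0 := fun x hx =>
    image_eq_zero_of_notMem_tsupport fun hx' => hx (hφ.support_subset hx')
  obtain ⟨F, hF⟩ := exists_periodization hℓ hφ.smooth.continuous hφ0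
  have h1 := congrArg (fun L : C(UnitAddTorus (Fin 2), ℂ) →L[ℂ] ℂ => L F)
    (sum_torusFunctional_eq_zero hℓ u h)
  -- For w ≠ 1 the point w x, reduced modulo the lattice, falls outside the triangle, where φ
  -- vanishes.
  have hj : ∀ j, j ≠ 0 → torusFunctional hℓ u j F = 0 := fun j hj => by
    rw [torusFunctional_apply]
    refine setIntegral_eq_zero_of_forall_eq_zero fun x hx => ?_
    rw [torusPoint_eq, hF, hφ0, mul_zero]
    intro hy
    obtain ⟨e1, e2⟩ := simpleRoot_planePoint hℓ (Int.fract (weylCoord ℓ j x 0))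
      (Int.fract (weylCoord ℓ j x 1))
    refine hj (eq_zero_of_weylCoord_eq hℓ hx hy (a := ⌊weylCoord ℓ j x 0⌋)
      (b := ⌊weylCoord ℓ j x 1⌋) ?_ ?_) <;>
    · rw [weight_apply, e1, e2, Int.self_sub_floor]
      push_cast
      ring
  have h0 : torusFunctional hℓ u 0 F = ∫ x in triangle ℓ, u x * φ x := by
    rw [torusFunctional_apply]
    refine setIntegral_congr_fun (isOpen_triangle ℓ).measurableSet fun x hx => ?_
    have hx' := planePoint_weight hℓ x
    have hI := mem_Ioo_of_planePoint_mem_triangle hℓ (hx'.symm ▸ hx)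
    have e0 : weylCoord ℓ 0 x 0 = weight ℓ (1, 0) x := rfl
    have e1 : weylCoord ℓ 0 x 1 = weight ℓ (0, 1) x := rfl
    simp only [torusPoint_eq]
    rw [hF, e0, e1, Int.fract_eq_self.2 ⟨hI.1.1.le, hI.1.2⟩, Int.fract_eq_self.2 ⟨hI.2.1.le, hI.2.2⟩,
      hx']
  simp only [sum_apply, smul_apply, zero_apply] at h1
  rw [Finset.sum_eq_single 0 (fun j _ hj0 => by rw [hj j hj0, smul_zero]) (by simp), h0] at h1
  simpa [weylSign] using h1

/-! ### Multiplicities and the heat trace -/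

theorem finite_energy_eq {ℓ : ℝ} (hℓ : 0 < ℓ) (lam : ℝ) :
    Finite {p : ℕ+ × ℕ+ // lam = energy ℓ (intPair p)} := by
  have hK : 0 < 16 * Real.pi ^ 2 / (9 * ℓ ^ 2) := by positivity
  obtain ⟨N, hN⟩ := exists_nat_gt (lam / (16 * Real.pi ^ 2 / (9 * ℓ ^ 2)))
  have hfin : {p : ℕ+ × ℕ+ | lam = energy ℓ (intPair p)}.Finite := by
    refine (Set.finite_Iic (N.succPNat, N.succPNat)).subset ?_
    rintro ⟨m, n⟩ hp
    have h1 : lam / (16 * Real.pi ^ 2 / (9 * ℓ ^ 2)) = (m : ℝ) ^ 2 + m * n + (n : ℝ) ^ 2 := by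
      rw [div_eq_iff hK.ne', mul_comm]
      simpa [energy, intPair] using hp
    rw [h1] at hN
    have h2 : (m : ℕ) ^ 2 + m * n + (n : ℕ) ^ 2 < N := by exact_mod_cast hN
    refine Prod.mk_le_mk.2 ⟨?_, ?_⟩ <;> rw [← PNat.coe_le_coe, Nat.succPNat_coe] <;>
      nlinarith [m.pos, n.pos]
  exact hfin

/-- The lower bound is linear independence. For the upper bound, pairing with the finitely many
`altWave` of energy `lam` embeds the eigenspace into the functions on the index set. -/
theorem rank_dirichletEigenspace_triangle {ℓ : ℝ} (hℓ : 0 < ℓ) (lam : ℝ) :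
    Module.rank ℂ (dirichletEigenspace (triangle ℓ) lam) =
      Cardinal.mk {p : ℕ+ × ℕ+ // lam = energy ℓ (intPair p)} := by
  refine le_antisymm ?_ (mk_le_rank_dirichletEigenspace hℓ lam)
  have hfin := finite_energy_eq hℓ lam
  have := Fintype.ofFinite {p : ℕ+ × ℕ+ // lam = energy ℓ (intPair p)}
  have hmem : ∀ k, MemLp (altWave ℓ k) 2 (volume.restrict (triangle ℓ)) := fun k =>
    memLp_triangle hℓ (contDiff_altWave ℓ k).continuous
  let Φ : dirichletEigenspace (triangle ℓ) lam →ₗ[ℂ]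
      ({p : ℕ+ × ℕ+ // lam = energy ℓ (intPair p)} → ℂ) :=
    { toFun := fun u p => ∫ x in triangle ℓ, (u : L2 (triangle ℓ)) x * altWave ℓ (intPair p.1) x
      map_add' := fun u v => funext fun p => L2.integral_add_mul _ _ (hmem _)
      map_smul' := fun c u => funext fun p => L2.integral_smul_mul _ _ _ }
  have hΦ : Function.Injective Φ := by
    rw [← LinearMap.ker_eq_bot, LinearMap.ker_eq_bot']
    intro u hu
    refine Subtype.ext (eq_zero_of_integral_mul_altWave hℓ _
      (integral_mul_altWave_eq_zero_of_dominant _ fun m n hm hn => ?_))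
    lift m to ℕ using hm.le
    lift n to ℕ using hn.le
    let p : ℕ+ × ℕ+ := (⟨m, by omega⟩, ⟨n, by omega⟩)
    -- Matching energy: the pairing is a coordinate of Φ u. Otherwise it vanishes by orthogonality
    -- of eigenspaces, and completeness then gives u = 0.
    by_cases hp : lam = energy ℓ (intPair p)
    · exact congrFun hu ⟨p, hp⟩
    · have h1 := SolvesDirichlet.integral_mul_eq_zero (isOpen_triangle ℓ) hp u.2
        (solvesDirichlet_altWaveL2 hℓ (intPair p))
      simp_rw [mul_comm ((u : L2 (triangle ℓ)) _)] at h1 ⊢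
      rwa [altWaveL2, integral_toLp_mul] at h1
  refine (LinearMap.rank_le_of_injective Φ hΦ).trans_eq ?_
  rw [rank_fun', Cardinal.mk_fintype]

theorem isDirichletEigenvalue_triangle_iff {ℓ : ℝ} (hℓ : 0 < ℓ) (lam : ℝ) :
    IsDirichletEigenvalue (triangle ℓ) lam ↔ ∃ p : ℕ+ × ℕ+, lam = energy ℓ (intPair p) := by
  constructor
  · rintro ⟨u, hu, hu0⟩
    by_contra! h
    have : IsEmpty {p : ℕ+ × ℕ+ // lam = energy ℓ (intPair p)} := ⟨fun p => h p.1 p.2⟩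
    have h1 := rank_dirichletEigenspace_triangle hℓ lam
    rw [Cardinal.mk_eq_zero, rank_zero_iff_forall_zero] at h1
    exact hu0 (congrArg Subtype.val (h1 ⟨u, hu⟩))
  · rintro ⟨p, rfl⟩
    exact ⟨_, solvesDirichlet_altWaveL2 hℓ (intPair p),
      (linearIndependent_altWaveL2 hℓ).ne_zero p⟩

/-- Group the pairs by energy: the terms over one fibre are equal, and the size of the fibre is the
multiplicity. Real numbers with empty fibre contribute zero on both sides. -/
theorem dirichletHeatTrace_triangle {ℓ : ℝ} (hℓ : 0 < ℓ) (t : ℝ) :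
    dirichletHeatTrace (triangle ℓ) t =
      ∑' (m : ℕ+) (n : ℕ+), ENNReal.ofReal (Real.exp (-energy ℓ (intPair (m, n)) * t)) := by
  rw [← ENNReal.tsum_prod (f := fun m n => ENNReal.ofReal (Real.exp (-energy ℓ (intPair (m, n)) * t))),
    ← (Equiv.sigmaFiberEquiv fun p : ℕ+ × ℕ+ => energy ℓ (intPair p)).tsum_eq, ENNReal.tsum_sigma',
    dirichletHeatTrace]
  refine tsum_congr fun lam => ?_
  have h1 : ∀ p : {p : ℕ+ × ℕ+ // energy ℓ (intPair p) = lam},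
      ENNReal.ofReal (Real.exp (-energy ℓ (intPair (p.1.1, p.1.2)) * t)) =
        ENNReal.ofReal (Real.exp (-lam * t)) := fun p => by
    rw [Prod.mk.eta, p.2]
  simp only [Equiv.sigmaFiberEquiv_apply]
  rw [tsum_congr h1, ENNReal.tsum_const, rank_dirichletEigenspace_triangle hℓ]
  simp_rw [eq_comm (a := lam)]
  rfl

end EquilateralTriangle

end

open EquilateralTriangle in
theorem mainTheorem5 (ℓ : ℝ) (hℓ : 0 < ℓ) :
    -- the two expressions for the Dirichlet heat trace
    (∀ t : ℝ, 0 < t → ∀ q : ℝ, q = Real.exp (-(16 * Real.pi ^ 2 / (27 * ℓ ^ 2)) * t) →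
      dirichletHeatTrace (triangle ℓ) t =
        ENNReal.ofReal ((Theta3 (q ^ 3) * Theta3 (q ^ 9) + Theta2 (q ^ 3) * Theta2 (q ^ 9)
          - 3 * Theta3 (q ^ 3) + 2) / 6)) ∧
    (∀ t : ℝ, 0 < t →
      dirichletHeatTrace (triangle ℓ) t =
        ∑' (m : ℕ+) (n : ℕ+), ENNReal.ofReal
          (Real.exp (-(16 * Real.pi ^ 2 / (9 * ℓ ^ 2)) *
            ((m : ℝ) ^ 2 + (m : ℝ) * (n : ℝ) + (n : ℝ) ^ 2) * t))) ∧
    -- the eigenvalues, first as a set, then with their multiplicities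
    (∀ lam : ℝ, IsDirichletEigenvalue (triangle ℓ) lam ↔
      ∃ m n : ℕ+, lam = 16 * Real.pi ^ 2 / (9 * ℓ ^ 2) *
        ((m : ℝ) ^ 2 + (m : ℝ) * (n : ℝ) + (n : ℝ) ^ 2)) ∧
    (∀ lam : ℝ, Module.rank ℂ (dirichletEigenspace (triangle ℓ) lam) =
      Cardinal.mk {p : ℕ+ × ℕ+ // lam = 16 * Real.pi ^ 2 / (9 * ℓ ^ 2) *
        ((p.1 : ℝ) ^ 2 + (p.1 : ℝ) * (p.2 : ℝ) + (p.2 : ℝ) ^ 2)}) ∧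
    -- the correspondence between pairs of positive integers and orbits
    Set.BijOn (fun p : ℕ+ × ℕ+ => orbit (2 * p.1 + p.2) (p.1 + 2 * p.2))
      Set.univ admissibleOrbits ∧
    (∀ m n : ℕ+, ∀ p ∈ orbit (2 * m + n) (m + 2 * n),
      16 * Real.pi ^ 2 / (27 * ℓ ^ 2) *
          ((p.1 : ℝ) ^ 2 - (p.1 : ℝ) * (p.2 : ℝ) + (p.2 : ℝ) ^ 2) =
        16 * Real.pi ^ 2 / (9 * ℓ ^ 2) *
          ((m : ℝ) ^ 2 + (m : ℝ) * (n : ℝ) + (n : ℝ) ^ 2)) := by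
  have hE : ∀ p : ℕ+ × ℕ+, energy ℓ (intPair p) = 16 * Real.pi ^ 2 / (9 * ℓ ^ 2) *
      ((p.1 : ℝ) ^ 2 + (p.1 : ℝ) * (p.2 : ℝ) + (p.2 : ℝ) ^ 2) := fun p => by
    simp [energy, intPair]
  refine ⟨fun t ht q hq => ?_, fun t ht => ?_, fun lam => ?_, fun lam => ?_, bijOn_orbit,
    fun m n p hp => ?_⟩
  · have h0 : 0 < q := hq ▸ Real.exp_pos _
    have h1 : q < 1 := by
      rw [hq, Real.exp_lt_one_iff, neg_mul, neg_lt_zero]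
      positivity
    rw [dirichletHeatTrace_triangle hℓ, ← tsum_pnat_pnat_eq_theta h0 h1]
    refine tsum_congr fun m => tsum_congr fun n => ?_
    -- The exponents agree because 3 · 16/27 = 16/9, which is why the theta functions are taken at
    -- q³ and q⁹.
    rw [hE, ← pow_mul, hq, ← Real.exp_nat_mul]
    congr 2
    push_cast
    ring
  · rw [dirichletHeatTrace_triangle hℓ]
    refine tsum_congr fun m => tsum_congr fun n => ?_
    rw [hE, neg_mul (16 * Real.pi ^ 2 / (9 * ℓ ^ 2))]
  · rw [isDirichletEigenvalue_triangle_iff hℓ, Prod.exists]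
    simp only [hE]
  · rw [rank_dirichletEigenspace_triangle hℓ]
    simp only [hE]
  · have h := congrArg (Int.cast : ℤ → ℝ) (orbit_quadraticForm hp)
    push_cast at h
    rw [h]
    field_simp
    ring
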